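/- An elementary cube in $\mathbb R^d$ is a product $Q=I_1\times\cdots\times I_d$ with each $I_i=\{m\}$ or $I_i=[m,m+1]$, $m\in\mathbb Z$; $\dim Q$ is the number of nondegenerate factors. A cubical complex $K$ in $\mathbb R^d$ is a set of elementary cubes which contains every elementary cube contained in one of its members (two elementary cubes that meet do so in an elementary cube). Its cubical chain complex $C_*(K)$ has as $C_k(K)$ the free abelian group on the $k$-dimensional cubes of $K$, with boundary given by $\partial[l,l+1]=\{l+1\}-\{l\}$, $\partial\{l\}=0$ and $\partial(I\times P)=\partial I\times P+(-1)^{\dim I}I\times\partial P$. The doubled cubical barycentric subdivision $2\,\mathrm{sd}(K)$ is the cubical complex with one cube for each pair $F\subseteq G$ of cubes of $K$, namely the elementary cube with vertex set $\{2\,\mathrm{bar}(C): F\subseteq C\subseteq G\}$, where $\mathrm{bar}(C)$ is the barycenter of $C$. An $m$-block over an alphabet $\Sigma$ is an expression $\sigma=x_0(1,a_1)x_1\cdots(1,a_m)x_m$ with $x_i\in\Sigma^*$ and $a_i\in\Sigma$. Replacing $(1,a_i)$ by $a_i$ or by the empty word $1$ gives the sub-blocks $\sigma(\{i\},\emptyset)$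 and $\sigma(\emptyset,\{i\})$. For $I\subseteq\{1,\dots,m\}$, the vertex $v_I(\sigma)$ is the word obtained by replacing $(1,a_i)$ by $a_i$ if $i\in I$ and by $1$ otherwise; $V(\sigma)$ is the set of all vertices. Two $0$-blocks are equivalent if they are equal; for $m\ge 1$, two $m$-blocks $\hat\sigma_1(1,a)x$ and $\hat\sigma_2(1,a')x'$ are equivalent if $\hat\sigma_1ax\equiv\hat\sigma_2a'x'$ and $\hat\sigma_1x\equiv\hat\sigma_2x'$. Blocks are considered up to equivalence. A block is in canonical form if no $(1,a_i)$ is followed immediately by the letter $a_i$; every block has a unique canonical form, and it is valid if in its canonical form no $(1,a)$ is followed immediately by another $(1,a)$. For $W\subseteq\Sigma^*$, the insertion chain complex $C_*(W)$ has as $C_k(W)$ the free abelian group on the valid $k$-blocks $\sigma$ with $V(\sigma)\subseteq W$, with boundary $\partial\sigma=\sum_{i=1}^{k}(-1)^{i+1}\left[\sigma(\{i\},\emptyset)-\sigma(\emptyset,\{i\})\right]$, where invalid blocks on the right-hand side are replaced by $0$. **Theorem.** Let $K$ be a finite cubical complex in $\mathbb R^d$. Then there is a finite set of words $W\subset\{a,b\}^*$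 such that $H_n(C_*(K))\cong H_n(C_*(W))$ for all $n\ge 0$. More precisely, there is a translation $t\in\mathbb Z^d$ such that all vertices of $K'=2\,\mathrm{sd}(K)+t$ lie in $\mathbb N^d$, and for every such $t$ the following holds. Let $W$ be the set of the words $$\Psi(m_1,\dots,m_d)=ab^{m_1}ab^{m_2}\cdots ab^{m_d}$$ for the vertices $(m_1,\dots,m_d)$ of $K'$. Then $W$ is finite, $H_n(C_*(K))\cong H_n(C_*(W))$ for all $n\ge 0$, and $\Psi$ extends to an isomorphism of chain complexes $C_*(K')\cong C_*(W)$ that maps each cube $I_1\times\cdots\times I_d$ of $K'$ to the block $a\xi_1\cdots a\xi_d$, where $\xi_i=b^m$ if $I_i=\{m\}$ and $\xi_i=b^m(1,b)$ if $I_i=[m,m+1]$. -/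

import Mathlib

open CategoryTheory

noncomputable section

namespace InsertionChain

/-! ## Chain complexes cut out of a module with a square-zero endomorphism -/

/-- The chain complex of abelian groups `⋯ → S 2 → S 1 → S 0`, for submodules `S n` of `M` and an
endomorphism `D` of `M` with `D ∘ D = 0` that maps `S (n + 1)` into `S n`. -/
def gradedComplex {M : Type} [AddCommGroup M] (D : M →ₗ[ℤ] M) (S : ℕ → Submodule ℤ M)
    (hS : ∀ n, ∀ x ∈ S (n + 1), D x ∈ S n) (hD : ∀ x, D (D x) = 0) :
    ChainComplex (ModuleCat ℤ) ℕ :=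
  ChainComplex.of (fun n => ModuleCat.of ℤ (S n))
    (fun n => ModuleCat.ofHom (D.restrict (hS n)))
    (fun n => by
      ext x
      exact hD x.1)

/-! ## Elementary cubes and cubical complexes -/

/-- An elementary interval: `[lo, lo + 1]` if `nondeg` is true, `{lo}` otherwise. -/
@[ext] structure ElemInterval where
  lo : ℤ
  nondeg : Bool

namespace ElemInterval

/-- The dimension of an elementary interval. -/
def dim (I : ElemInterval) : ℕ := if I.nondeg then 1 else 0

/-- The right end point. -/
def hi (I : ElemInterval) : ℤ := I.lo + I.dim

/-- The interval as a subset of the real line. -/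
def toSet (I : ElemInterval) : Set ℝ := Set.Icc (I.lo : ℝ) (I.hi : ℝ)

/-- The degenerate interval `{k}`. -/
def point (k : ℤ) : ElemInterval := ⟨k, false⟩

/-- The boundary of an elementary interval: `{l + 1} - {l}` for `[l, l + 1]`, and `0` for `{l}`. -/
def bd (I : ElemInterval) : ElemInterval →₀ ℤ :=
  if I.nondeg then Finsupp.single (point (I.lo + 1)) 1 - Finsupp.single (point I.lo) 1 else 0

lemma lo_le_hi (I : ElemInterval) : I.lo ≤ I.hi := by unfold hi; omega

lemma hi_le (I : ElemInterval) : I.hi ≤ I.lo + 1 := by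
  unfold hi dim; split <;> simp

lemma nondeg_iff (I : ElemInterval) : I.nondeg = true ↔ I.hi = I.lo + 1 := by
  unfold hi dim; split <;> simp_all

lemma deg_iff (I : ElemInterval) : I.nondeg = false ↔ I.hi = I.lo := by
  unfold hi dim; split <;> simp_all

lemma ext_hi {I J : ElemInterval} (h1 : I.lo = J.lo) (h2 : I.hi = J.hi) : I = J := by
  refine ElemInterval.ext h1 ?_
  have hI := I.deg_iff
  have hJ := J.deg_iff
  rw [h1, h2, ← hJ] at hI
  cases h : I.nondeg <;> cases h' : J.nondeg <;> simp_all

lemma hi_mk_decide (k : ℤ) (p : Prop) [Decidable p] :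
    (ElemInterval.mk k (decide p)).hi = if p then k + 1 else k := by
  by_cases h : p <;> simp [hi, dim, h]

end ElemInterval

/-- An elementary cube `I₁ × ⋯ × I_d` in `ℝ^d`. -/
abbrev ElemCube (d : ℕ) : Type := Fin d → ElemInterval

namespace ElemCube

/-- The cube as a subset of `ℝ^d`. -/
def toSet {d : ℕ} (Q : ElemCube d) : Set (Fin d → ℝ) := {x | ∀ i, x i ∈ (Q i).toSet}

/-- The dimension: the number of nondegenerate factors. -/
def dim {d : ℕ} (Q : ElemCube d) : ℕ := ∑ i, (Q i).dim

/-- The zero-dimensional cube `{v}`. -/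
def point {d : ℕ} (v : Fin d → ℤ) : ElemCube d := fun i => ElemInterval.point (v i)

/-- The vertices of an elementary cube. -/
def vertices {d : ℕ} (Q : ElemCube d) : Set (Fin d → ℤ) :=
  {v | ∀ i, v i = (Q i).lo ∨ v i = (Q i).hi}

/-- The cube `Q + t`. -/
def translate {d : ℕ} (t : Fin d → ℤ) (Q : ElemCube d) : ElemCube d :=
  fun i => ⟨(Q i).lo + t i, (Q i).nondeg⟩

/-- The cubical boundary operator on the free abelian group on all elementary cubes of `ℝ^d`:
`∂ (I × P) = ∂ I × P + (-1) ^ dim I • I × ∂ P`. -/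
def bd : (d : ℕ) → (ElemCube d →₀ ℤ) →ₗ[ℤ] (ElemCube d →₀ ℤ)
  | 0 => 0
  | d + 1 => Finsupp.lift (ElemCube (d + 1) →₀ ℤ) ℤ (ElemCube (d + 1)) fun Q =>
      Finsupp.lmapDomain ℤ ℤ (fun I => (Fin.cons I (Fin.tail Q) : ElemCube (d + 1))) (Q 0).bd
      + (-1 : ℤ) ^ (Q 0).dim •
        Finsupp.lmapDomain ℤ ℤ (fun P => (Fin.cons (Q 0) P : ElemCube (d + 1)))
          (bd d (Finsupp.single (Fin.tail Q) 1))

lemma bd_single_succ {d : ℕ} (I : ElemInterval) (P : ElemCube d) :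
    bd (d + 1) (Finsupp.single (Fin.cons I P) 1) =
      Finsupp.lmapDomain ℤ ℤ (fun J => (Fin.cons J P : ElemCube (d + 1))) I.bd
      + (-1 : ℤ) ^ I.dim •
        Finsupp.lmapDomain ℤ ℤ (fun P => (Fin.cons I P : ElemCube (d + 1)))
          (bd d (Finsupp.single P 1)) := by
  simp [bd]

lemma bd_cons {d : ℕ} (I : ElemInterval) (c : ElemCube d →₀ ℤ) :
    bd (d + 1) (Finsupp.lmapDomain ℤ ℤ (fun P => (Fin.cons I P : ElemCube (d + 1))) c) =
      c.sum (fun P r => r •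
        Finsupp.lmapDomain ℤ ℤ (fun J => (Fin.cons J P : ElemCube (d + 1))) I.bd)
      + (-1 : ℤ) ^ I.dim •
        Finsupp.lmapDomain ℤ ℤ (fun P => (Fin.cons I P : ElemCube (d + 1))) (bd d c) := by
  induction c using Finsupp.induction_linear with
  | zero => simp
  | add f g hf hg =>
    rw [map_add, map_add, hf, hg, Finsupp.sum_add_index' (by simp)
      (by intros; rw [add_smul]), map_add, map_add, smul_add]
    abel
  | single P r =>
    have h : Finsupp.single P r = r • Finsupp.single P (1 : ℤ) := by simp
    rw [Finsupp.sum_single_index (by simp), h, map_smul, map_smul, map_smul, map_smul,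
      smul_comm _ r, ← smul_add, ← bd_single_succ]
    simp

lemma bd_bd : ∀ (d : ℕ) (c : ElemCube d →₀ ℤ), bd d (bd d c) = 0
  | 0, c => by simp [bd]
  | d + 1, c => by
    induction c using Finsupp.induction_linear with
    | zero => simp
    | add f g hf hg => rw [map_add, map_add, hf, hg, add_zero]
    | single Q r =>
      have h : Finsupp.single Q r = r • Finsupp.single Q (1 : ℤ) := by simp
      rw [h, map_smul, map_smul]
      suffices H : bd (d + 1) (bd (d + 1) (Finsupp.single Q 1)) = 0 by rw [H, smul_zero]
      obtain ⟨I, P, rfl⟩ : ∃ I P, Q = (Fin.cons I P : ElemCube (d + 1)) :=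
        ⟨Q 0, Fin.tail Q, (Fin.cons_self_tail Q).symm⟩
      rw [bd_single_succ, map_add, map_smul, bd_cons, bd_bd d]
      have hz : ∀ (J : ElemInterval), J.nondeg = false → ∀ c : ElemCube d →₀ ℤ,
          (c.sum (fun P r => r •
            Finsupp.lmapDomain ℤ ℤ (fun J' => (Fin.cons J' P : ElemCube (d + 1))) J.bd)) = 0 := by
        intro J hJ c
        simp [ElemInterval.bd, hJ]
      rcases hI : I.nondeg with _ | _
      · rw [hz I hI]
        simp [ElemInterval.bd, hI]
      · simp only [ElemInterval.bd, hI, ElemInterval.dim, if_true, map_sub, map_zero, smul_zero,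
          add_zero, pow_one, Finsupp.lmapDomain_apply, Finsupp.mapDomain_single, bd_single_succ]
        simp only [ElemInterval.point, Bool.false_eq_true, if_false, Finsupp.mapDomain_zero,
          zero_add, pow_zero, one_smul]
        simp only [Finsupp.mapDomain, Finsupp.sum, smul_sub, Finsupp.smul_single, smul_eq_mul,
          mul_one, Finset.sum_sub_distrib]
        simp

end ElemCube

/-- A cubical complex in `ℝ^d`. -/
structure CubicalComplex (d : ℕ) where
  cells : Set (ElemCube d)
  down_closed : ∀ Q₁ Q₂ : ElemCube d, Q₁.toSet ⊆ Q₂.toSet → Q₂ ∈ cells → Q₁ ∈ cells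
  inter : ∀ Q₁ ∈ cells, ∀ Q₂ ∈ cells, (Q₁.toSet ∩ Q₂.toSet).Nonempty →
    ∃ Q : ElemCube d, Q.toSet = Q₁.toSet ∩ Q₂.toSet

namespace ElemCube

lemma toSet_subset_iff {d : ℕ} (P Q : ElemCube d) :
    P.toSet ⊆ Q.toSet ↔ ∀ i, (Q i).lo ≤ (P i).lo ∧ (P i).hi ≤ (Q i).hi := by
  constructor
  · intro h i
    have h1 : (fun i => ((P i).lo : ℝ)) ∈ Q.toSet := h fun i =>
      ⟨le_rfl, by exact_mod_cast (P i).lo_le_hi⟩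
    have h2 : (fun i => ((P i).hi : ℝ)) ∈ Q.toSet := h fun i =>
      ⟨by exact_mod_cast (P i).lo_le_hi, le_rfl⟩
    have h3 : ((Q i).lo : ℝ) ≤ (P i).lo := (h1 i).1
    have h4 : ((P i).hi : ℝ) ≤ (Q i).hi := (h2 i).2
    exact ⟨by exact_mod_cast h3, by exact_mod_cast h4⟩
  · intro h x hx i
    have h1 : ((Q i).lo : ℝ) ≤ (P i).lo := by exact_mod_cast (h i).1
    have h2 : ((P i).hi : ℝ) ≤ (Q i).hi := by exact_mod_cast (h i).2
    exact ⟨h1.trans (hx i).1, (hx i).2.trans h2⟩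

/-- Any two elementary cubes that meet do so in an elementary cube. -/
lemma exists_inter {d : ℕ} (P Q : ElemCube d) (h : (P.toSet ∩ Q.toSet).Nonempty) :
    ∃ R : ElemCube d, R.toSet = P.toSet ∩ Q.toSet := by
  obtain ⟨x, hP, hQ⟩ := h
  have key : ∀ i, ∃ J : ElemInterval,
      J.lo = max (P i).lo (Q i).lo ∧ J.hi = min (P i).hi (Q i).hi := by
    intro i
    have h1 : (P i).lo ≤ (Q i).hi := by exact_mod_cast (hP i).1.trans (hQ i).2
    have h2 : (Q i).lo ≤ (P i).hi := by exact_mod_cast (hQ i).1.trans (hP i).2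
    have a1 := (P i).lo_le_hi
    have a2 := (P i).hi_le
    have b1 := (Q i).lo_le_hi
    have b2 := (Q i).hi_le
    refine ⟨⟨max (P i).lo (Q i).lo,
      decide (max (P i).lo (Q i).lo ≠ min (P i).hi (Q i).hi)⟩, rfl, ?_⟩
    rw [ElemInterval.hi_mk_decide]
    split <;> omega
  choose R hR using key
  refine ⟨R, ?_⟩
  ext y
  simp only [toSet, Set.mem_ofPred_eq, Set.mem_inter_iff, ← forall_and]
  refine forall_congr' fun i => ?_
  simp only [ElemInterval.toSet, Set.mem_Icc, (hR i).1, (hR i).2]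
  push_cast
  simp only [max_le_iff, le_min_iff]
  tauto

lemma bd_mem {d : ℕ} (Q : ElemCube d) :
    bd d (Finsupp.single Q 1) ∈
      Finsupp.supported ℤ ℤ {P : ElemCube d | P.toSet ⊆ Q.toSet ∧ P.dim + 1 = Q.dim} := by
  induction d with
  | zero => simp [bd]
  | succ d ih =>
    obtain ⟨I, P, rfl⟩ : ∃ I P, Q = (Fin.cons I P : ElemCube (d + 1)) :=
      ⟨Q 0, Fin.tail Q, (Fin.cons_self_tail Q).symm⟩
    rw [bd_single_succ]
    refine Submodule.add_mem _ ?_ (Submodule.smul_mem _ _ ?_)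
    · unfold ElemInterval.bd
      split
      · rename_i h
        have hh := I.nondeg_iff.1 h
        simp only [map_sub, Finsupp.lmapDomain_apply, Finsupp.mapDomain_single]
        refine Submodule.sub_mem _ (Finsupp.single_mem_supported _ _ ?_)
          (Finsupp.single_mem_supported _ _ ?_) <;>
        · refine ⟨(toSet_subset_iff _ _).2 fun i => ?_, ?_⟩
          · refine Fin.cases ?_ (fun j => ?_) i
            · simp [ElemInterval.point, ElemInterval.hi, ElemInterval.dim, h]
            · simp
          · unfold dim
            rw [Fin.sum_univ_succ, Fin.sum_univ_succ]
            simp only [Fin.cons_zero, Fin.cons_succ]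
            simp only [ElemInterval.point, ElemInterval.dim, h, Bool.false_eq_true, if_false,
              if_true]
            omega
      · simp
    · have hmem := Submodule.mem_map_of_mem
        (f := Finsupp.lmapDomain ℤ ℤ (fun P => (Fin.cons I P : ElemCube (d + 1)))) (ih P)
      rw [Finsupp.lmapDomain_supported] at hmem
      refine Finsupp.supported_mono ?_ hmem
      rintro _ ⟨R, ⟨h1, h2⟩, rfl⟩
      refine ⟨(toSet_subset_iff _ _).2 fun i => ?_, ?_⟩
      · rw [toSet_subset_iff] at h1
        refine Fin.cases ?_ (fun j => ?_) i
        · simp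
        · simpa using h1 j
      · simp only [dim, Fin.sum_univ_succ, Fin.cons_zero, Fin.cons_succ] at h2 ⊢
        omega

end ElemCube

namespace CubicalComplex

/-- The group of cubical `n`-chains, as a subgroup of the free abelian group on all cubes:
the chains that involve only `n`-dimensional cubes of `K`. -/
def chains {d : ℕ} (K : CubicalComplex d) (n : ℕ) : Submodule ℤ (ElemCube d →₀ ℤ) :=
  Finsupp.supported ℤ ℤ {Q | Q ∈ K.cells ∧ Q.dim = n}

lemma bd_mem_chains {d : ℕ} (K : CubicalComplex d) (n : ℕ) (c : ElemCube d →₀ ℤ)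
    (hc : c ∈ K.chains (n + 1)) : ElemCube.bd d c ∈ K.chains n := by
  rw [chains, Finsupp.supported_eq_span_single] at hc
  induction hc using Submodule.span_induction with
  | mem x hx =>
    obtain ⟨Q, ⟨hQ, hn⟩, rfl⟩ := hx
    refine Finsupp.supported_mono ?_ (ElemCube.bd_mem Q)
    rintro P ⟨h1, h2⟩
    exact ⟨K.down_closed _ _ h1 hQ, by omega⟩
  | zero => simp
  | add x y _ _ hx hy => rw [map_add]; exact Submodule.add_mem _ hx hy
  | smul r x _ hx => rw [map_smul]; exact Submodule.smul_mem _ _ hx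

/-- The cubical chain complex of `K`, with integer coefficients. -/
def chainComplex {d : ℕ} (K : CubicalComplex d) : ChainComplex (ModuleCat ℤ) ℕ :=
  gradedComplex (ElemCube.bd d) K.chains K.bd_mem_chains (ElemCube.bd_bd d)

/-- The vertices of `K`. -/
def vertices {d : ℕ} (K : CubicalComplex d) : Set (Fin d → ℤ) :=
  {v | ElemCube.point v ∈ K.cells}

/-- The translate `K + t`. -/
def translate {d : ℕ} (K : CubicalComplex d) (t : Fin d → ℤ) : CubicalComplex d where
  cells := ElemCube.translate t '' K.cells
  down_closed := by
    rintro P _ h ⟨Q, hQ, rfl⟩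
    rw [ElemCube.toSet_subset_iff] at h
    refine ⟨ElemCube.translate (-t) P, K.down_closed _ Q ?_ hQ, ?_⟩
    · rw [ElemCube.toSet_subset_iff]
      intro i
      have h1 : (Q i).lo + t i ≤ (P i).lo := (h i).1
      have h2 : (P i).lo + (P i).dim ≤ (Q i).lo + t i + (Q i).dim := (h i).2
      change (Q i).lo ≤ (P i).lo + -t i ∧ (P i).lo + -t i + (P i).dim ≤ (Q i).lo + (Q i).dim
      omega
    · funext i
      simp [ElemCube.translate]
  inter := fun P _ Q _ h => ElemCube.exists_inter P Q h

end CubicalComplex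

/-! ## The doubled cubical barycentric subdivision -/

namespace ElemCube

/-- Twice the barycenter of a cube. -/
def doubledBarycenter {d : ℕ} (C : ElemCube d) : Fin d → ℤ := fun i => (C i).lo + (C i).hi

/-- For cubes `F ⊆ G`, the elementary cube with opposite vertices `2 bar F` and `2 bar G`. This is
the face of the doubled subdivision that belongs to the interval `[F, G]` of the face poset; its
vertices are the points `2 bar C` with `F ⊆ C ⊆ G`, see `vertices_sdCube`. -/
def sdCube {d : ℕ} (F G : ElemCube d) : ElemCube d := fun i =>
  ⟨min (F.doubledBarycenter i) (G.doubledBarycenter i),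
    decide (F.doubledBarycenter i ≠ G.doubledBarycenter i)⟩

lemma sdCube_lo {d : ℕ} (F G : ElemCube d) (i : Fin d) :
    (sdCube F G i).lo = min ((F i).lo + (F i).hi) ((G i).lo + (G i).hi) := rfl

lemma sdCube_hi {d : ℕ} {F G : ElemCube d} (h : F.toSet ⊆ G.toSet) (i : Fin d) :
    (sdCube F G i).hi = max ((F i).lo + (F i).hi) ((G i).lo + (G i).hi) := by
  have h1 := (toSet_subset_iff _ _).1 h i
  have a1 := (F i).lo_le_hi
  have a2 := (F i).hi_le
  have b1 := (G i).lo_le_hi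
  have b2 := (G i).hi_le
  rw [sdCube, ElemInterval.hi_mk_decide]
  change (if (F i).lo + (F i).hi ≠ (G i).lo + (G i).hi
      then min ((F i).lo + (F i).hi) ((G i).lo + (G i).hi) + 1
      else min ((F i).lo + (F i).hi) ((G i).lo + (G i).hi)) = _
  by_cases h : (F i).lo + (F i).hi = (G i).lo + (G i).hi
  · rw [if_neg (not_not.2 h)]; omega
  · rw [if_pos h]; omega

lemma vertices_sdCube {d : ℕ} {F G : ElemCube d} (h : F.toSet ⊆ G.toSet) :
    (sdCube F G).vertices =
      {v | ∃ C : ElemCube d, F.toSet ⊆ C.toSet ∧ C.toSet ⊆ G.toSet ∧ v = C.doubledBarycenter} := by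
  have h0 := (toSet_subset_iff _ _).1 h
  ext v
  simp only [vertices, Set.mem_ofPred_eq, sdCube_lo, sdCube_hi h, toSet_subset_iff]
  constructor
  · intro hv
    refine ⟨fun i => if v i = (F i).lo + (F i).hi then F i else G i, ?_, ?_, ?_⟩
    · intro i
      have := h0 i
      dsimp only
      split <;> simp_all
    · intro i
      have := h0 i
      dsimp only
      split <;> simp_all
    · funext i
      have := hv i
      simp only [doubledBarycenter]
      split <;> omega
  · rintro ⟨C, hF, hG, rfl⟩ i
    have := hF i
    have := hG i
    have := (F i).lo_le_hi
    have := (F i).hi_le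
    have := (G i).lo_le_hi
    have := (G i).hi_le
    have := (C i).lo_le_hi
    have := (C i).hi_le
    simp only [doubledBarycenter]
    omega

end ElemCube

/-- The cubical barycentric subdivision of `K`, stretched by the factor `2`: its cubes correspond to
the intervals `[F, G]` in the poset of (nonempty) faces of `K`. -/
def CubicalComplex.twoSd {d : ℕ} (K : CubicalComplex d) : CubicalComplex d where
  cells := {Q | ∃ F ∈ K.cells, ∃ G ∈ K.cells, F.toSet ⊆ G.toSet ∧ Q = ElemCube.sdCube F G}
  down_closed := by
    rintro P _ hP ⟨F, hF, G, hG, hFG, rfl⟩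
    have h0 := (ElemCube.toSet_subset_iff _ _).1 hFG
    have h1 := (ElemCube.toSet_subset_iff _ _).1 hP
    simp only [ElemCube.sdCube_lo, ElemCube.sdCube_hi hFG] at h1
    let F' : ElemCube d := fun i =>
      if (P i).lo = (F i).lo + (F i).hi ∨ (P i).hi = (F i).lo + (F i).hi then F i else G i
    let G' : ElemCube d := fun i =>
      if (P i).lo = (G i).lo + (G i).hi ∨ (P i).hi = (G i).lo + (G i).hi then G i else F i
    have hF'G' : F'.toSet ⊆ G'.toSet := by
      rw [ElemCube.toSet_subset_iff]
      intro i
      have e0 := h0 i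
      have e1 := h1 i
      have := (F i).lo_le_hi
      have := (F i).hi_le
      have := (G i).lo_le_hi
      have := (G i).hi_le
      have := (P i).lo_le_hi
      have := (P i).hi_le
      simp only [F', G']
      split <;> split <;> omega
    have hG' : G'.toSet ⊆ G.toSet := by
      rw [ElemCube.toSet_subset_iff]
      intro i
      have e0 := h0 i
      simp only [G']
      split <;> omega
    refine ⟨F', K.down_closed _ _ (hF'G'.trans hG') hG, G', K.down_closed _ _ hG' hG, hF'G', ?_⟩
    funext i
    refine ElemInterval.ext_hi ?_ ?_
    · rw [ElemCube.sdCube_lo]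
      have e0 := h0 i
      have e1 := h1 i
      have := (F i).lo_le_hi
      have := (F i).hi_le
      have := (G i).lo_le_hi
      have := (G i).hi_le
      have := (P i).lo_le_hi
      have := (P i).hi_le
      simp only [F', G']
      split <;> split <;> omega
    · rw [ElemCube.sdCube_hi hF'G']
      have e0 := h0 i
      have e1 := h1 i
      have := (F i).lo_le_hi
      have := (F i).hi_le
      have := (G i).lo_le_hi
      have := (G i).hi_le
      have := (P i).lo_le_hi
      have := (P i).hi_le
      simp only [F', G']
      split <;> split <;> omega
  inter := fun P _ Q _ h => ElemCube.exists_inter P Q h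

/-! ## Blocks -/

/-- The symbols that blocks are made of: letters `a ∈ Σ`, and edges `(1, a)` with `a ∈ Σ`. -/
inductive BlockSym (α : Type) : Type
  | letter (a : α) : BlockSym α
  | edge (a : α) : BlockSym α

/-- A block `x₀ (1, a₁) x₁ ⋯ (1, a_m) x_m`, before passing to equivalence classes, is a finite
sequence of letters and edges. -/
abbrev RawBlock (α : Type) : Type := List (BlockSym α)

namespace RawBlock

open BlockSym

variable {α : Type}

/-- The dimension of a block: the number of its edges. -/
def dim : RawBlock α → ℕ
  | [] => 0
  | letter _ :: σ => dim σ
  | edge _ :: σ => dim σ + 1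

/-- The sub-block obtained by replacing the edge `(1, a)` with index `i` by the letter `a` if `u` is
true (an upper index), and by the empty word if `u` is false (a lower index). The edges are counted
from the left, starting with index `0`. -/
def facet (u : Bool) : ℕ → RawBlock α → RawBlock α
  | _, [] => []
  | i, letter a :: σ => letter a :: facet u i σ
  | 0, edge a :: σ => if u then letter a :: σ else σ
  | i + 1, edge a :: σ => edge a :: facet u i σ

/-- The vertex `v_I(σ)`, where the set `I` of indices is given by its indicator function. -/
def vertex : RawBlock α → (ℕ → Bool) → List α
  | [], _ => []
  | letter a :: σ, I => a :: vertex σ I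
  | edge a :: σ, I => (if I 0 then [a] else []) ++ vertex σ (fun k => I (k + 1))

/-- The recursive definition of equivalence for `m`-blocks: equality if `m = 0`; otherwise both
blocks are reduced at their last edge. -/
def EquivAux : ℕ → RawBlock α → RawBlock α → Prop
  | 0, σ, τ => σ = τ
  | m + 1, σ, τ => EquivAux m (facet true m σ) (facet true m τ) ∧
      EquivAux m (facet false m σ) (facet false m τ)

/-- Equivalence of blocks. -/
def Equiv (σ τ : RawBlock α) : Prop := dim σ = dim τ ∧ EquivAux (dim σ) σ τ

/-- A block is in canonical form if no edge `(1, a)` is followed immediately by the letter `a`. -/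
def Canonical (σ : RawBlock α) : Prop :=
  List.IsChain (fun x y => ∀ a, x = edge a → y ≠ letter a) σ

/-- No edge `(1, a)` is followed immediately by another edge `(1, a)`. -/
def Nondegenerate (σ : RawBlock α) : Prop :=
  List.IsChain (fun x y => ∀ a, x = edge a → y ≠ edge a) σ

/-- Insert the value `u` at position `i`. -/
def ins (i : ℕ) (u : Bool) (I : ℕ → Bool) : ℕ → Bool :=
  fun k => if k < i then I k else if k = i then u else I (k - 1)

lemma ins_zero_zero (u : Bool) (I : ℕ → Bool) : ins 0 u I 0 = u := by simp [ins]

lemma ins_zero_shift (u : Bool) (I : ℕ → Bool) : (fun k => ins 0 u I (k + 1)) = I := by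
  funext k; simp [ins]

lemma ins_succ_zero (i : ℕ) (u : Bool) (I : ℕ → Bool) : ins (i + 1) u I 0 = I 0 := by simp [ins]

lemma ins_succ_shift (i : ℕ) (u : Bool) (I : ℕ → Bool) :
    (fun k => ins (i + 1) u I (k + 1)) = ins i u (fun k => I (k + 1)) := by
  funext k
  simp only [ins]
  by_cases h1 : k < i
  · simp [h1]
  · by_cases h2 : k = i
    · simp [h2]
    · have : k - 1 + 1 = k := by omega
      simp [h1, h2, this]

lemma vertex_facet (u : Bool) : ∀ (σ : RawBlock α) (i : ℕ) (I : ℕ → Bool),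
    vertex (facet u i σ) I = vertex σ (ins i u I)
  | [], _, _ => rfl
  | letter a :: σ, i, I => by simp [facet, vertex, vertex_facet u σ]
  | edge a :: σ, 0, I => by
    simp only [facet, vertex, ins_zero_zero, ins_zero_shift]
    cases u <;> simp [vertex]
  | edge a :: σ, i + 1, I => by
    simp only [facet, vertex, ins_succ_zero, ins_succ_shift, vertex_facet u σ]

lemma dim_facet (u : Bool) : ∀ (σ : RawBlock α) (i : ℕ), i < dim σ →
    dim (facet u i σ) + 1 = dim σ
  | [], _, h => by simp [dim] at h
  | letter a :: σ, i, h => by simpa [facet, dim] using dim_facet u σ i h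
  | edge a :: σ, 0, _ => by cases u <;> simp [facet, dim]
  | edge a :: σ, i + 1, h => by
    simp only [dim, Nat.add_lt_add_iff_right] at h
    simpa [facet, dim] using dim_facet u σ i h

lemma facet_of_le (u : Bool) : ∀ (σ : RawBlock α) (i : ℕ), dim σ ≤ i → facet u i σ = σ
  | [], _, _ => rfl
  | letter a :: σ, i, h => by simpa [facet] using facet_of_le u σ i h
  | edge a :: σ, 0, h => by simp [dim] at h
  | edge a :: σ, i + 1, h => by
    simp only [dim, Nat.add_le_add_iff_right] at h
    simpa [facet] using facet_of_le u σ i h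

lemma vertex_congr : ∀ (σ : RawBlock α) (I J : ℕ → Bool), (∀ k < dim σ, I k = J k) →
    vertex σ I = vertex σ J
  | [], _, _, _ => rfl
  | letter a :: σ, I, J, h => by simp only [vertex, vertex_congr σ I J h]
  | edge a :: σ, I, J, h => by
    simp only [vertex, h 0 (by simp [dim])]
    rw [vertex_congr σ _ (fun k => J (k + 1)) fun k hk => h (k + 1) (by simpa [dim] using hk)]

lemma eq_of_dim_zero : ∀ (σ : RawBlock α) (I : ℕ → Bool), dim σ = 0 →
    σ = (vertex σ I).map letter
  | [], _, _ => rfl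
  | letter a :: σ, I, h => by simpa [vertex] using eq_of_dim_zero σ I h
  | edge a :: σ, I, h => by simp [dim] at h

lemma equivAux_iff : ∀ (m : ℕ) (σ τ : RawBlock α), dim σ = m → dim τ = m →
    (EquivAux m σ τ ↔ ∀ I, vertex σ I = vertex τ I)
  | 0, σ, τ, hσ, hτ => by
    constructor
    · rintro rfl I; rfl
    · intro h
      change σ = τ
      rw [eq_of_dim_zero σ (fun _ => false) hσ, eq_of_dim_zero τ (fun _ => false) hτ, h]
  | m + 1, σ, τ, hσ, hτ => by
    have e : ∀ u (ρ : RawBlock α), dim ρ = m + 1 → dim (facet u m ρ) = m := fun u ρ h => by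
      have := dim_facet u ρ m (by omega)
      omega
    rw [EquivAux, equivAux_iff m _ _ (e _ _ hσ) (e _ _ hτ),
      equivAux_iff m _ _ (e _ _ hσ) (e _ _ hτ)]
    simp only [vertex_facet]
    constructor
    · rintro ⟨h1, h0⟩ I
      have key : ∀ (ρ : RawBlock α), dim ρ = m + 1 →
          vertex ρ I = vertex ρ (ins m (I m) I) := fun ρ hρ => by
        apply vertex_congr
        intro k hk
        rw [hρ] at hk
        simp only [ins]
        split
        · rfl
        · have : k = m := by omega
          simp [this]
      rw [key σ hσ, key τ hτ]
      cases I m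
      · exact h0 I
      · exact h1 I
    · exact fun h => ⟨fun I => h _, fun I => h _⟩

/-- Two blocks are equivalent if and only if they have the same dimension and the same vertex for
each set of indices. -/
lemma equiv_iff (σ τ : RawBlock α) :
    Equiv σ τ ↔ dim σ = dim τ ∧ ∀ I, vertex σ I = vertex τ I :=
  and_congr_right fun h => equivAux_iff _ σ τ rfl h.symm

/-- The setoid of equivalent blocks. -/
instance setoid (α : Type) : Setoid (RawBlock α) where
  r := Equiv
  iseqv :=
    { refl := fun σ => (equiv_iff _ _).2 ⟨rfl, fun _ => rfl⟩
      symm := fun h => by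
        rw [equiv_iff] at h ⊢
        exact ⟨h.1.symm, fun I => (h.2 I).symm⟩
      trans := fun h h' => by
        rw [equiv_iff] at h h' ⊢
        exact ⟨h.1.trans h'.1, fun I => (h.2 I).trans (h'.2 I)⟩ }

lemma equiv_def (σ τ : RawBlock α) : σ ≈ τ ↔ dim σ = dim τ ∧ ∀ I, vertex σ I = vertex τ I :=
  equiv_iff σ τ

lemma facet_equiv (u : Bool) (i : ℕ) {σ τ : RawBlock α} (h : σ ≈ τ) :
    facet u i σ ≈ facet u i τ := by
  rw [equiv_def] at h ⊢
  refine ⟨?_, fun I => by rw [vertex_facet, vertex_facet, h.2]⟩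
  by_cases hi : i < dim σ
  · have h1 := dim_facet u σ i hi
    have h2 := dim_facet u τ i (h.1 ▸ hi)
    omega
  · rw [facet_of_le u σ i (by omega), facet_of_le u τ i (by omega), h.1]

lemma cons_equiv (x : BlockSym α) {σ τ : RawBlock α} (h : σ ≈ τ) :
    (x :: σ : RawBlock α) ≈ x :: τ := by
  rw [equiv_def] at h ⊢
  cases x <;> simp [dim, vertex, h.1, h.2]

lemma append_equiv (ρ : RawBlock α) {σ τ : RawBlock α} (h : σ ≈ τ) :
    (ρ ++ σ : RawBlock α) ≈ ρ ++ τ := by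
  induction ρ with
  | nil => exact h
  | cons x ρ ih => exact cons_equiv x ih

lemma commute (a : α) (σ : RawBlock α) :
    (edge a :: letter a :: σ : RawBlock α) ≈ letter a :: edge a :: σ := by
  rw [equiv_def]
  refine ⟨rfl, fun I => ?_⟩
  cases h : I 0 <;> simp [vertex, h]

lemma canonical_letter (a : α) {σ : RawBlock α} (h : Canonical σ) :
    Canonical (letter a :: σ) := by
  cases σ with
  | nil => simp [Canonical]
  | cons y σ => exact List.IsChain.cons_cons (by simp) h

lemma exists_canonical_edge (a : α) : ∀ σ : RawBlock α, Canonical σ →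
    ∃ τ : RawBlock α, Canonical τ ∧ (edge a :: σ : RawBlock α) ≈ τ
  | [], _ => ⟨[edge a], by simp [Canonical], Setoid.refl _⟩
  | edge c :: σ, h => ⟨edge a :: edge c :: σ, List.IsChain.cons_cons (by simp) h, Setoid.refl _⟩
  | letter c :: σ, h => by
    by_cases hc : a = c
    · subst hc
      obtain ⟨τ, h1, h2⟩ := exists_canonical_edge a σ h.tail
      exact ⟨letter a :: τ, canonical_letter a h1, Setoid.trans (commute a σ) (cons_equiv _ h2)⟩
    · refine ⟨edge a :: letter c :: σ, List.IsChain.cons_cons ?_ h, Setoid.refl _⟩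
      rintro _ ⟨⟩ ⟨⟩
      exact hc rfl

/-- Each block is equivalent to one in canonical form. -/
lemma exists_canonical : ∀ σ : RawBlock α, ∃ τ : RawBlock α, Canonical τ ∧ σ ≈ τ
  | [] => ⟨[], by simp [Canonical], Setoid.refl _⟩
  | letter a :: σ => by
    obtain ⟨τ, h1, h2⟩ := exists_canonical σ
    exact ⟨letter a :: τ, canonical_letter a h1, cons_equiv _ h2⟩
  | edge a :: σ => by
    obtain ⟨τ, h1, h2⟩ := exists_canonical σ
    obtain ⟨τ', h3, h4⟩ := exists_canonical_edge a τ h1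
    exact ⟨τ', h3, Setoid.trans (cons_equiv _ h2) h4⟩

lemma exists_of_not_nondegenerate : ∀ σ : RawBlock α, ¬ Nondegenerate σ →
    ∃ (ρ : RawBlock α) (a : α) (τ : RawBlock α), σ = ρ ++ edge a :: edge a :: τ
  | [], h => (h (by simp [Nondegenerate])).elim
  | [x], h => (h (by simp [Nondegenerate])).elim
  | x :: y :: σ, h => by
    by_cases hxy : ∀ a, x = edge a → y ≠ edge a
    · have h' : ¬ Nondegenerate (y :: σ) := fun h' => h (List.IsChain.cons_cons hxy h')
      obtain ⟨ρ, a, τ, e⟩ := exists_of_not_nondegenerate (y :: σ) h'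
      exact ⟨x :: ρ, a, τ, by rw [e]; rfl⟩
    · push Not at hxy
      obtain ⟨a, rfl, rfl⟩ := hxy
      exact ⟨[], a, σ, rfl⟩

lemma vertex_swap (a : α) (τ : RawBlock α) : ∀ (ρ : RawBlock α) (I : ℕ → Bool),
    vertex (ρ ++ edge a :: edge a :: τ) (ins (dim ρ) true (ins (dim ρ) false I)) =
      vertex (ρ ++ edge a :: edge a :: τ) (ins (dim ρ) false (ins (dim ρ) true I))
  | [], I => by
    simp [dim, vertex, ins]
  | letter c :: ρ, I => by simpa [dim, vertex] using vertex_swap a τ ρ I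
  | edge c :: ρ, I => by
    simp only [dim, List.cons_append, vertex, ins_succ_zero, ins_succ_shift]
    rw [vertex_swap a τ ρ]

lemma no_swap : ∀ (σ : RawBlock α) (n : ℕ), Canonical σ → Nondegenerate σ → n + 1 < dim σ →
    (∀ I, vertex σ (ins n true (ins n false I)) = vertex σ (ins n false (ins n true I))) → False
  | [], _, _, _, h, _ => by simp [dim] at h
  | letter c :: σ, n, h1, h2, h3, h4 =>
    no_swap σ n h1.tail h2.tail h3 fun I => by simpa [vertex] using h4 I
  | edge c :: σ, n + 1, h1, h2, h3, h4 =>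
    no_swap σ n h1.tail h2.tail (by simpa [dim] using h3) fun I => by
      have := h4 (fun k => I (k - 1))
      simpa [vertex, ins_succ_zero, ins_succ_shift] using this
  | [edge c], 0, _, _, h, _ => by simp [dim] at h
  | edge c :: letter e :: σ, 0, h1, _, _, h4 => by
    have h := h4 (fun _ => false)
    simp [vertex, ins_zero_zero, ins_zero_shift] at h
    exact (List.isChain_cons_cons.1 h1).1 c rfl (by rw [h.1])
  | edge c :: edge e :: σ, 0, _, h2, _, h4 => by
    have h := h4 (fun _ => false)
    simp [vertex, ins] at h
    exact (List.isChain_cons_cons.1 h2).1 c rfl (by rw [h])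

lemma dim_append (ρ σ : RawBlock α) : dim (ρ ++ σ) = dim ρ + dim σ := by
  induction ρ with
  | nil => simp [dim]
  | cons x ρ ih =>
    cases x
    · simp [dim, ih]
    · simp only [List.cons_append, dim, ih]; omega

lemma facet_append_lt (u : Bool) (σ : RawBlock α) : ∀ (ρ : RawBlock α) (i : ℕ), i < dim ρ →
    facet u i (ρ ++ σ) = facet u i ρ ++ σ
  | [], _, h => by simp [dim] at h
  | letter a :: ρ, i, h => by simpa [facet] using facet_append_lt u σ ρ i h
  | edge a :: ρ, 0, _ => by cases u <;> simp [facet]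
  | edge a :: ρ, i + 1, h => by
    simp only [dim, Nat.add_lt_add_iff_right] at h
    simpa [facet] using facet_append_lt u σ ρ i h

lemma facet_append_add (u : Bool) (σ : RawBlock α) (j : ℕ) : ∀ ρ : RawBlock α,
    facet u (dim ρ + j) (ρ ++ σ) = ρ ++ facet u j σ
  | [] => by simp [dim]
  | letter a :: ρ => by simpa [facet, dim] using facet_append_add u σ j ρ
  | edge a :: ρ => by
    have : dim (edge a :: ρ) + j = dim ρ + j + 1 := by simp only [dim]; omega
    rw [this]
    simpa [facet] using facet_append_add u σ j ρ

/-- The cubical boundary of a sequence of letters and edges, before passing to equivalence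
classes. -/
def rawBd (σ : RawBlock α) : RawBlock α →₀ ℤ :=
  ∑ i ∈ Finset.range (dim σ), (-1 : ℤ) ^ i •
    (Finsupp.single (facet true i σ) 1 - Finsupp.single (facet false i σ) 1)

lemma rawBd_letter (a : α) (σ : RawBlock α) :
    rawBd (letter a :: σ) = Finsupp.lmapDomain ℤ ℤ (letter a :: ·) (rawBd σ) := by
  simp only [rawBd, dim, facet, map_sum, map_smul, map_sub, Finsupp.lmapDomain_apply,
    Finsupp.mapDomain_single]

lemma rawBd_edge (a : α) (σ : RawBlock α) :
    rawBd (edge a :: σ) = Finsupp.single (letter a :: σ) 1 - Finsupp.single σ 1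
      - Finsupp.lmapDomain ℤ ℤ (edge a :: ·) (rawBd σ) := by
  rw [rawBd, dim, Finset.sum_range_succ', rawBd, map_sum, ← sub_eq_zero]
  simp only [facet, pow_succ, map_smul, map_sub, Finsupp.lmapDomain_apply,
    Finsupp.mapDomain_single, mul_neg, mul_one, neg_smul, Finset.sum_neg_distrib]
  simp only [pow_zero, one_smul, if_true, Bool.false_eq_true, if_false]
  abel

lemma rawBd_rawBd : ∀ σ : RawBlock α,
    Finsupp.lift (RawBlock α →₀ ℤ) ℤ (RawBlock α) rawBd (rawBd σ) = 0 := by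
  have hl : ∀ (a : α) (c : RawBlock α →₀ ℤ),
      Finsupp.lift (RawBlock α →₀ ℤ) ℤ (RawBlock α) rawBd
        (Finsupp.lmapDomain ℤ ℤ (letter a :: ·) c) =
      Finsupp.lmapDomain ℤ ℤ (letter a :: ·)
        (Finsupp.lift (RawBlock α →₀ ℤ) ℤ (RawBlock α) rawBd c) := by
    intro a c
    induction c using Finsupp.induction_linear with
    | zero => simp
    | add f g hf hg => simp only [map_add, hf, hg]
    | single σ r =>
      simp only [Finsupp.lmapDomain_apply, Finsupp.mapDomain_single]
      simp [rawBd_letter, Finsupp.mapDomain_smul]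
  have he : ∀ (a : α) (c : RawBlock α →₀ ℤ),
      Finsupp.lift (RawBlock α →₀ ℤ) ℤ (RawBlock α) rawBd
        (Finsupp.lmapDomain ℤ ℤ (edge a :: ·) c) =
      Finsupp.lmapDomain ℤ ℤ (letter a :: ·) c - c - Finsupp.lmapDomain ℤ ℤ (edge a :: ·)
        (Finsupp.lift (RawBlock α →₀ ℤ) ℤ (RawBlock α) rawBd c) := by
    intro a c
    induction c using Finsupp.induction_linear with
    | zero => simp
    | add f g hf hg => simp only [map_add, hf, hg]; abel
    | single σ r =>
      simp only [Finsupp.lmapDomain_apply, Finsupp.mapDomain_single]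
      simp [rawBd_edge, smul_sub, Finsupp.mapDomain_smul]
  intro σ
  induction σ with
  | nil => simp [rawBd, dim]
  | cons x σ ih =>
    cases x with
    | letter a => rw [rawBd_letter, hl, ih, map_zero]
    | edge a =>
      rw [rawBd_edge, map_sub, map_sub, he, ih]
      simp [rawBd_letter]

end RawBlock

/-- Blocks, up to equivalence. -/
def Block (α : Type) : Type := Quotient (RawBlock.setoid α)

namespace Block

variable {α : Type}

/-- The class of a sequence of letters and edges. -/
def mk (σ : RawBlock α) : Block α := Quotient.mk _ σ

lemma mk_eq_mk {σ τ : RawBlock α} : mk σ = mk τ ↔ σ ≈ τ := Quotient.eq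

/-- The dimension of a block. -/
def dim : Block α → ℕ :=
  Quotient.lift RawBlock.dim fun σ τ h => ((RawBlock.equiv_def σ τ).1 h).1

/-- The set `V(σ)` of vertices of a block. -/
def vertices : Block α → Set (List α) :=
  Quotient.lift (fun σ => Set.range (RawBlock.vertex σ)) fun σ τ h =>
    congrArg Set.range (funext ((RawBlock.equiv_def σ τ).1 h).2)

/-- The sub-blocks `σ({i}, ∅)` (for `u = true`) and `σ(∅, {i})` (for `u = false`). -/
def facet (u : Bool) (i : ℕ) : Block α → Block α :=
  Quotient.map (RawBlock.facet u i) fun _ _ h => RawBlock.facet_equiv u i h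

/-- A block is valid if its canonical form has no two consecutive edges `(1, a)(1, a)`. -/
def IsValid (q : Block α) : Prop :=
  ∃ σ : RawBlock α, q = mk σ ∧ σ.Canonical ∧ σ.Nondegenerate

open Classical in
/-- The generator `q` of the free abelian group if `q` is valid, and `0` otherwise. -/
def gen (q : Block α) : Block α →₀ ℤ := if q.IsValid then Finsupp.single q 1 else 0

/-- The boundary operator, `∂ σ = ∑ i, (-1) ^ i • (σ({i}, ∅) - σ(∅, {i}))` with the edges counted
from `0`, where invalid blocks on the right hand side are replaced by zero. -/
def bd : (Block α →₀ ℤ) →ₗ[ℤ] (Block α →₀ ℤ) :=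
  Finsupp.lift (Block α →₀ ℤ) ℤ (Block α) fun q =>
    ∑ i ∈ Finset.range q.dim, (-1 : ℤ) ^ i • (gen (q.facet true i) - gen (q.facet false i))

lemma not_isValid (ρ : RawBlock α) (a : α) (τ : RawBlock α) :
    ¬ (mk (ρ ++ BlockSym.edge a :: BlockSym.edge a :: τ)).IsValid := by
  rintro ⟨σ, h, h1, h2⟩
  rw [mk_eq_mk, RawBlock.equiv_def] at h
  refine RawBlock.no_swap σ ρ.dim h1 h2 ?_ fun I => ?_
  · rw [← h.1, RawBlock.dim_append]
    simp only [RawBlock.dim]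
    omega
  · rw [← h.2, ← h.2]
    exact RawBlock.vertex_swap a τ ρ I

lemma exists_of_not_isValid (q : Block α) (h : ¬ q.IsValid) :
    ∃ (ρ : RawBlock α) (a : α) (τ : RawBlock α),
      q = mk (ρ ++ BlockSym.edge a :: BlockSym.edge a :: τ) := by
  obtain ⟨σ, rfl⟩ : ∃ σ, q = mk σ := by
    obtain ⟨σ, h⟩ := Quotient.exists_rep q
    exact ⟨σ, h.symm⟩
  obtain ⟨σ', h1, h2⟩ := RawBlock.exists_canonical σ
  have h3 : ¬ σ'.Nondegenerate := fun h3 => h ⟨σ', mk_eq_mk.2 h2, h1, h3⟩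
  obtain ⟨ρ, a, τ, rfl⟩ := RawBlock.exists_of_not_nondegenerate σ' h3
  exact ⟨ρ, a, τ, mk_eq_mk.2 h2⟩

lemma facet_mk (u : Bool) (i : ℕ) (σ : RawBlock α) : (mk σ).facet u i = mk (σ.facet u i) := rfl

lemma dim_mk (σ : RawBlock α) : (mk σ).dim = σ.dim := rfl

lemma bd_single (q : Block α) : bd (Finsupp.single q 1) =
    ∑ i ∈ Finset.range q.dim, (-1 : ℤ) ^ i • (gen (q.facet true i) - gen (q.facet false i)) := by
  simp [bd]

lemma bd_of_not_isValid (q : Block α) (h : ¬ q.IsValid) : bd (Finsupp.single q 1) = 0 := by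
  obtain ⟨ρ, a, τ, rfl⟩ := exists_of_not_isValid q h
  rw [bd_single, dim_mk]
  have hd : RawBlock.dim (ρ ++ BlockSym.edge a :: BlockSym.edge a :: τ) = ρ.dim + (τ.dim + 2) := by
    rw [RawBlock.dim_append]; rfl
  have hf : ∀ u, (mk (ρ ++ BlockSym.edge a :: BlockSym.edge a :: τ)).facet u ρ.dim
      = (mk (ρ ++ BlockSym.edge a :: BlockSym.edge a :: τ)).facet u (ρ.dim + 1) := by
    intro u
    rw [facet_mk, facet_mk, RawBlock.facet_append_add, mk_eq_mk]
    have := RawBlock.facet_append_add u (BlockSym.edge a :: BlockSym.edge a :: τ) 0 ρ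
    rw [add_zero] at this
    rw [this]
    refine RawBlock.append_equiv ρ ?_
    cases u
    · exact Setoid.refl _
    · exact Setoid.symm (RawBlock.commute a τ)
  have h0 : ∀ u i, i ≠ ρ.dim → i ≠ ρ.dim + 1 →
      gen ((mk (ρ ++ BlockSym.edge a :: BlockSym.edge a :: τ)).facet u i) = 0 := by
    intro u i h1 h2
    rw [facet_mk, gen, if_neg]
    rcases lt_or_ge i ρ.dim with h | h
    · rw [RawBlock.facet_append_lt u _ _ _ h]
      exact not_isValid _ _ _
    · obtain ⟨j, rfl⟩ : ∃ j, i = ρ.dim + (j + 1 + 1) := ⟨i - ρ.dim - 2, by omega⟩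
      rw [RawBlock.facet_append_add]
      exact not_isValid _ _ _
  rw [Finset.sum_eq_add (ρ.dim) (ρ.dim + 1) (by omega)]
  · rw [hf, hf, pow_succ]
    simp
  · rintro i _ ⟨h1, h2⟩
    rw [h0 _ _ h1 h2, h0 _ _ h1 h2, sub_zero, smul_zero]
  · intro h; simp [hd] at h
  · intro h; simp [hd] at h

lemma bd_bd (c : Block α →₀ ℤ) : bd (bd c) = 0 := by
  have h1 : ∀ q : Block α, bd (gen q) = bd (Finsupp.single q 1) := by
    intro q
    by_cases h : q.IsValid
    · rw [gen, if_pos h]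
    · rw [gen, if_neg h, bd_of_not_isValid q h, map_zero]
  have h2 : ∀ σ : RawBlock α, bd (Finsupp.single (mk σ) 1) =
      Finsupp.lift (Block α →₀ ℤ) ℤ (RawBlock α) (fun τ => gen (mk τ)) σ.rawBd := by
    intro σ
    have h : ∀ τ : RawBlock α, Finsupp.lift (Block α →₀ ℤ) ℤ (RawBlock α)
        (fun τ => gen (mk τ)) (Finsupp.single τ 1) = gen (mk τ) := fun τ => by simp
    simp only [bd_single, RawBlock.rawBd, map_sum, map_smul, map_sub, h, facet_mk, dim_mk]
  have h3 : ∀ c : RawBlock α →₀ ℤ,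
      bd (Finsupp.lift (Block α →₀ ℤ) ℤ (RawBlock α) (fun τ => gen (mk τ)) c) =
        Finsupp.lift (Block α →₀ ℤ) ℤ (RawBlock α) (fun τ => gen (mk τ))
          (Finsupp.lift (RawBlock α →₀ ℤ) ℤ (RawBlock α) RawBlock.rawBd c) := by
    intro c
    induction c using Finsupp.induction_linear with
    | zero => simp only [map_zero]
    | add f g hf hg => simp only [map_add, hf, hg]
    | single σ r =>
      have h : Finsupp.single σ r = r • Finsupp.single σ (1 : ℤ) := by simp
      rw [h]
      simp only [map_smul]
      congr 1
      simp [h1, h2]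
  induction c using Finsupp.induction_linear with
  | zero => simp
  | add f g hf hg => rw [map_add, map_add, hf, hg, add_zero]
  | single q r =>
    obtain ⟨σ, rfl⟩ : ∃ σ, q = mk σ := by
      obtain ⟨σ, h⟩ := Quotient.exists_rep q
      exact ⟨σ, h.symm⟩
    have h : Finsupp.single (mk σ) r = r • Finsupp.single (mk σ) (1 : ℤ) := by simp
    rw [h, map_smul, map_smul, h2, h3, RawBlock.rawBd_rawBd, map_zero, smul_zero]

lemma vertices_facet (u : Bool) (i : ℕ) (q : Block α) : (q.facet u i).vertices ⊆ q.vertices := by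
  induction q using Quotient.inductionOn with
  | h σ =>
    rintro _ ⟨I, rfl⟩
    exact ⟨RawBlock.ins i u I, (RawBlock.vertex_facet u σ i I).symm⟩

lemma dim_facet (u : Bool) (i : ℕ) (q : Block α) (h : i < q.dim) :
    (q.facet u i).dim + 1 = q.dim := by
  induction q using Quotient.inductionOn with
  | h σ => exact RawBlock.dim_facet u σ i h

end Block

/-! ## The insertion chain complex -/

/-- The insertion block complex of a set `W` of words: the valid blocks with all vertices in `W`. -/
def insertionBlocks {α : Type} (W : Set (List α)) : Set (Block α) :=
  {q | q.IsValid ∧ q.vertices ⊆ W}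

/-- The group of insertion `n`-chains of `W`: the free abelian group on the `n`-dimensional blocks
of the insertion block complex, as a subgroup of the free abelian group on all blocks. -/
def insertionChains {α : Type} (W : Set (List α)) (n : ℕ) : Submodule ℤ (Block α →₀ ℤ) :=
  Finsupp.supported ℤ ℤ {q | q ∈ insertionBlocks W ∧ q.dim = n}

lemma bd_mem_insertionChains {α : Type} (W : Set (List α)) (n : ℕ) (c : Block α →₀ ℤ)
    (hc : c ∈ insertionChains W (n + 1)) : Block.bd c ∈ insertionChains W n := by
  rw [insertionChains, Finsupp.supported_eq_span_single] at hc
  induction hc using Submodule.span_induction with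
  | mem x hx =>
    obtain ⟨q, ⟨⟨_, hW⟩, hn⟩, rfl⟩ := hx
    have hg : ∀ u, ∀ i ∈ Finset.range q.dim, Block.gen (q.facet u i) ∈ insertionChains W n := by
      intro u i hi
      unfold Block.gen
      split
      · rename_i hv
        refine Finsupp.single_mem_supported _ _
          ⟨⟨hv, (Block.vertices_facet u i q).trans hW⟩, ?_⟩
        have := Block.dim_facet u i q (Finset.mem_range.1 hi)
        omega
      · exact Submodule.zero_mem _
    change Block.bd (Finsupp.single q 1) ∈ _
    rw [Block.bd_single]
    exact Submodule.sum_mem _ fun i hi =>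
      Submodule.smul_mem _ _ (Submodule.sub_mem _ (hg _ i hi) (hg _ i hi))
  | zero => simp
  | add x y _ _ hx hy => rw [map_add]; exact Submodule.add_mem _ hx hy
  | smul r x _ hx => rw [map_smul]; exact Submodule.smul_mem _ _ hx

/-- The insertion chain complex of a set of words, with integer coefficients. -/
def insertionComplex {α : Type} (W : Set (List α)) : ChainComplex (ModuleCat ℤ) ℕ :=
  gradedComplex Block.bd (insertionChains W) (bd_mem_insertionChains W) Block.bd_bd

/-- The inclusion of the insertion `n`-chains of `W` into the free abelian group on all blocks. -/
def insertionComplexIncl {α : Type} (W : Set (List α)) (n : ℕ) :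
    (insertionComplex W).X n →ₗ[ℤ] (Block α →₀ ℤ) :=
  (insertionChains W n).subtype

/-- A cube of `K`, as an element of the cubical chain complex. -/
def CubicalComplex.cube {d : ℕ} (K : CubicalComplex d) (Q : ElemCube d) (hQ : Q ∈ K.cells) :
    K.chainComplex.X Q.dim :=
  (⟨Finsupp.single Q 1, Finsupp.single_mem_supported ℤ 1 ⟨hQ, rfl⟩⟩ : K.chains Q.dim)

/-! ## From cubes to words -/

/-- The alphabet `{a, b}`. -/
inductive AB : Type
  | a : AB
  | b : AB

/-- The word `a b^{m₁} ⋯ a b^{m_d}`. -/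
def cubeWord {d : ℕ} (m : Fin d → ℕ) : List AB :=
  (List.ofFn fun i => AB.a :: List.replicate (m i) AB.b).flatten

/-- The block `a ξ₁ ⋯ a ξ_d` of an elementary cube `I₁ × ⋯ × I_d` with nonnegative coordinates,
where `ξ_i = b^m` if `I_i = {m}` and `ξ_i = b^m (1, b)` if `I_i = [m, m + 1]`. -/
def cubeBlock {d : ℕ} (Q : ElemCube d) : RawBlock AB :=
  (List.ofFn fun i => BlockSym.letter AB.a ::
    (List.replicate (Q i).lo.toNat (BlockSym.letter AB.b) ++
      if (Q i).nondeg then [BlockSym.edge AB.b] else [])).flatten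

/-- All vertices of `K` have nonnegative coordinates. -/
def CubicalComplex.IsNonneg {d : ℕ} (K : CubicalComplex d) : Prop :=
  ∀ v ∈ K.vertices, ∀ i, 0 ≤ v i

/-- The words `a b^{m₁} ⋯ a b^{m_d}` of the vertices `(m₁, …, m_d) ∈ ℕ^d` of `K`. -/
def CubicalComplex.words {d : ℕ} (K : CubicalComplex d) : Set (List AB) :=
  cubeWord '' {m | (fun i => (m i : ℤ)) ∈ K.vertices}

end InsertionChain

end

/-!
Two independent facts are combined.

*Subdivision preserves homology.* Cubical chains of `ℝ^d` are the `d`-fold tensor power of the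
chains of intervals (`cross`, `bd_cross`), so it suffices to work on the line. There `subdiv` sends
`[k, k + 1]` to `[2k, 2k + 1] + [2k + 1, 2k + 2]`, `collapse` is induced by `k ↦ ⌈k / 2⌉`, the
composite `collapse ∘ subdiv` is the identity, and `htpy` is an explicit homotopy from
`subdiv ∘ collapse` to the identity. The tensor powers `powMap` and `powHtpy` inherit these
identities in every dimension. They restrict to `K` and its doubled subdivision because they are
local: each elementary cube `P` has a carrier, the smallest elementary cube `Q` with `P ⊆ 2Q`; the
cubes of the doubled subdivision are exactly those with carrier in `K` (`mem_twoSd_iff`), and none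
of the operators leaves a carrier. Translating a complex does not change its homology either.

*Cubes are blocks.* In the nonnegative orthant, `cubeBlock` commutes with the boundary already on
sequences of letters and edges (`rawBd_cubeBlock`), and the vertices of the block of a cube are the
words of the vertices of the cube (`vertices_cubeBlock`); hence a cube can be recovered from its
block. Conversely, let all vertices of a valid block be words `a b^{m₁} ⋯ a b^{m_d}`. All vertices
contain the same number of letters `a`, so all edges are `(1, b)`; in canonical form such an edge is
followed neither by `b` nor by another edge `(1, b)`, so at most one edge can follow each `a`, at
the end of the run of letters `b`. The block is thus the block of an elementary cube
(`exists_eq_cubeBlock`). The vertices of this cube lie in the complex, and for a doubled subdivision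
this forces the cube itself to be there: its vertex with the most odd coordinates has the same
carrier as the cube (`mem_twoSd_of_vertices`).
-/

noncomputable section

namespace InsertionChain

/-! ### Maps between complexes cut out of modules -/

section GradedComplex

variable {M N : Type} [AddCommGroup M] [AddCommGroup N]
  {D : M →ₗ[ℤ] M} {S : ℕ → Submodule ℤ M}
  {hS : ∀ n, ∀ x ∈ S (n + 1), D x ∈ S n} {hD : ∀ x, D (D x) = 0}
  {E : N →ₗ[ℤ] N} {T : ℕ → Submodule ℤ N}
  {hT : ∀ n, ∀ x ∈ T (n + 1), E x ∈ T n} {hE : ∀ x, E (E x) = 0}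

lemma gradedComplex_d (n : ℕ) : (gradedComplex D S hS hD).d (n + 1) n =
    (ModuleCat.ofHom (D.restrict (hS n)) : ModuleCat.of ℤ (S (n + 1)) ⟶ ModuleCat.of ℤ (S n)) :=
  ChainComplex.of_d (fun n => ModuleCat.of ℤ (S n))
    (fun n => ModuleCat.ofHom (D.restrict (hS n))) n

/-- The chain map induced by a linear map of the ambient modules. -/
def gradedMap (f : M →ₗ[ℤ] N) (hf : ∀ n, ∀ x ∈ S n, f x ∈ T n)
    (hc : ∀ n, ∀ x ∈ S n, E (f x) = f (D x)) :
    gradedComplex D S hS hD ⟶ gradedComplex E T hT hE :=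
  ChainComplex.ofHom (X := gradedComplex D S hS hD) (Y := gradedComplex E T hT hE)
    (fun n => (ModuleCat.ofHom (f.restrict (hf n)) :
      ModuleCat.of ℤ (S n) ⟶ ModuleCat.of ℤ (T n))) (fun n => by
    rw [gradedComplex_d, gradedComplex_d]
    refine ModuleCat.hom_ext (LinearMap.ext fun x => Subtype.ext ?_)
    exact hc _ x.1 x.2)

/-- Linear maps `f`, `g` that are mutually inverse up to a homotopy `H` on one side induce
isomorphisms in homology. The complex has no differential out of degree `0`, so the homotopy
identity in that degree needs `E` to vanish on `T 0`. -/
lemma homology_iso_of_homotopy (f : M →ₗ[ℤ] N) (g : N →ₗ[ℤ] M) (H : N →ₗ[ℤ] N)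
    (hf : ∀ n, ∀ x ∈ S n, f x ∈ T n) (hfc : ∀ x, E (f x) = f (D x))
    (hg : ∀ n, ∀ x ∈ T n, g x ∈ S n) (hgc : ∀ x, D (g x) = g (E x))
    (hH : ∀ n, ∀ x ∈ T n, H x ∈ T (n + 1)) (hE0 : ∀ x ∈ T 0, E x = 0)
    (hgf : ∀ x, g (f x) = x) (hfg : ∀ y, E (H y) + H (E y) = f (g y) - y) (n : ℕ) :
    Nonempty ((gradedComplex D S hS hD).homology n ≅ (gradedComplex E T hT hE).homology n) := by
  let F : gradedComplex D S hS hD ⟶ gradedComplex E T hT hE := gradedMap f hf fun _ x _ => hfc x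
  let G : gradedComplex E T hT hE ⟶ gradedComplex D S hS hD := gradedMap g hg fun _ x _ => hgc x
  let hom : ∀ i j, (gradedComplex E T hT hE).X i ⟶ (gradedComplex E T hT hE).X j := fun i j =>
    if h : i + 1 = j then
      (ModuleCat.ofHom (H.restrict (q := T j) fun x hx => h ▸ hH i x hx) :
        ModuleCat.of ℤ (T i) ⟶ ModuleCat.of ℤ (T j)) else 0
  have hom_succ : ∀ i, hom i (i + 1) = (ModuleCat.ofHom (H.restrict (hH i)) :
      ModuleCat.of ℤ (T i) ⟶ ModuleCat.of ℤ (T (i + 1))) := fun i => dif_pos rfl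
  let h : Homotopy (G ≫ F) (𝟙 _) :=
    { hom := hom
      zero := fun i j hij => dif_neg hij
      comm := by
        intro i
        cases i with
        | zero =>
          rw [Homotopy.dNext_zero_chainComplex, Homotopy.prevD_chainComplex, zero_add,
            hom_succ, gradedComplex_d]
          refine ModuleCat.hom_ext (LinearMap.ext fun x => Subtype.ext ?_)
          have := hfg x.1
          rw [hE0 x.1 x.2, map_zero, add_zero, eq_sub_iff_add_eq] at this
          exact this.symm
        | succ i =>
          rw [Homotopy.dNext_succ_chainComplex, Homotopy.prevD_chainComplex, hom_succ,
            hom_succ, gradedComplex_d, gradedComplex_d]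
          refine ModuleCat.hom_ext (LinearMap.ext fun x => Subtype.ext ?_)
          have := hfg x.1
          rw [eq_sub_iff_add_eq, add_comm (E _)] at this
          exact this.symm }
  have h' : F ≫ G = 𝟙 _ := by
    refine HomologicalComplex.hom_ext _ _ fun i => ModuleCat.hom_ext (LinearMap.ext fun x =>
      Subtype.ext ?_)
    exact hgf x.1
  exact ⟨HomotopyEquiv.toHomologyIso ⟨F, G, Homotopy.ofEq h', h⟩ n⟩

/-- A linear map that restricts to bijections of all chain groups induces an isomorphism of
chain complexes. -/
lemma isIso_gradedMap (f : M →ₗ[ℤ] N) (hf : ∀ n, ∀ x ∈ S n, f x ∈ T n)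
    (hc : ∀ n, ∀ x ∈ S n, E (f x) = f (D x))
    (hinj : ∀ n, Set.InjOn f (S n)) (hsurj : ∀ n, ∀ y ∈ T n, ∃ x ∈ S n, f x = y) :
    IsIso (gradedMap (hS := hS) (hD := hD) (hT := hT) (hE := hE) f hf hc) := by
  have h : ∀ n, IsIso ((gradedMap (hS := hS) (hD := hD) (hT := hT) (hE := hE) f hf hc).f n) := by
    intro n
    have hb : Function.Bijective (f.restrict (hf n)) := by
      refine ⟨fun x y hxy => Subtype.ext (hinj n x.2 y.2 (congrArg Subtype.val hxy)), fun y => ?_⟩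
      obtain ⟨x, hx, hxy⟩ := hsurj n y.1 y.2
      exact ⟨⟨x, hx⟩, Subtype.ext hxy⟩
    exact Iso.isIso_hom (X := ModuleCat.of ℤ (S n)) (Y := ModuleCat.of ℤ (T n))
      (LinearEquiv.ofBijective _ hb).toModuleIso
  exact HomologicalComplex.Hom.isIso_of_components _

end GradedComplex

/-! ### Tensor powers of operators on chains of intervals -/

lemma linearMap_mem_of_single {ι M : Type} [AddCommGroup M] {s : Set ι} {T : Submodule ℤ M}
    (f : (ι →₀ ℤ) →ₗ[ℤ] M) (h : ∀ i ∈ s, f (Finsupp.single i 1) ∈ T) {x : ι →₀ ℤ}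
    (hx : x ∈ Finsupp.supported ℤ ℤ s) : f x ∈ T := by
  rw [Finsupp.supported_eq_span_single] at hx
  induction hx using Submodule.span_induction with
  | mem x hx => obtain ⟨i, hi, rfl⟩ := hx; exact h i hi
  | zero => simp
  | add x y _ _ hx hy => rw [map_add]; exact Submodule.add_mem _ hx hy
  | smul r x _ hx => rw [map_smul]; exact Submodule.smul_mem _ _ hx

namespace ElemInterval

/-- The boundary operator on chains of elementary intervals. -/
def bdLin : (ElemInterval →₀ ℤ) →ₗ[ℤ] (ElemInterval →₀ ℤ) := Finsupp.linearCombination ℤ bd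

/-- The grading sign `I ↦ (-1) ^ dim I • I`. -/
def sign : (ElemInterval →₀ ℤ) →ₗ[ℤ] (ElemInterval →₀ ℤ) :=
  Finsupp.linearCombination ℤ fun I => Finsupp.single I ((-1) ^ I.dim)

lemma linearMap_ext {M : Type} [AddCommGroup M] {f g : (ElemInterval →₀ ℤ) →ₗ[ℤ] M}
    (h : ∀ k, f (Finsupp.single ⟨k, false⟩ 1) = g (Finsupp.single ⟨k, false⟩ 1))
    (h' : ∀ k, f (Finsupp.single ⟨k, true⟩ 1) = g (Finsupp.single ⟨k, true⟩ 1)) : f = g := by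
  refine Finsupp.lhom_ext' fun I => LinearMap.ext_ring ?_
  obtain ⟨k, _ | _⟩ := I
  · exact h k
  · exact h' k

@[simp] lemma bdLin_point (k : ℤ) : bdLin (Finsupp.single ⟨k, false⟩ 1) = 0 := by
  simp [bdLin, bd]

@[simp] lemma bdLin_edge (k : ℤ) : bdLin (Finsupp.single ⟨k, true⟩ 1) =
    Finsupp.single ⟨k + 1, false⟩ 1 - Finsupp.single ⟨k, false⟩ 1 := by
  simp [bdLin, bd, point]

@[simp] lemma sign_point (k : ℤ) :
    sign (Finsupp.single ⟨k, false⟩ 1) = Finsupp.single ⟨k, false⟩ 1 := by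
  simp [sign, dim]

@[simp] lemma sign_edge (k : ℤ) :
    sign (Finsupp.single ⟨k, true⟩ 1) = -Finsupp.single ⟨k, true⟩ 1 := by
  simp [sign, dim]

lemma sign_comp_sign : sign ∘ₗ sign = LinearMap.id := by
  apply linearMap_ext <;> simp

lemma sign_comp_bdLin : sign ∘ₗ bdLin = -(bdLin ∘ₗ sign) := by
  apply linearMap_ext <;> simp

lemma sign_mem {x : ElemInterval →₀ ℤ} {s : Set ElemInterval}
    (hx : x ∈ Finsupp.supported ℤ ℤ s) : sign x ∈ Finsupp.supported ℤ ℤ s :=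
  linearMap_mem_of_single sign (fun I hI => by
    rw [sign, Finsupp.linearCombination_single, one_smul]
    exact Finsupp.single_mem_supported _ _ hI) hx

end ElemInterval

namespace ElemCube

open ElemInterval

/-- The cross product of a chain of intervals with a chain of cubes, `I × P` on generators. -/
def cross {d : ℕ} :
    (ElemInterval →₀ ℤ) →ₗ[ℤ] (ElemCube d →₀ ℤ) →ₗ[ℤ] (ElemCube (d + 1) →₀ ℤ) :=
  Finsupp.linearCombination ℤ fun I =>
    Finsupp.lmapDomain ℤ ℤ fun P => (Fin.cons I P : ElemCube (d + 1))

lemma cross_single {d : ℕ} (I : ElemInterval) (P : ElemCube d) :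
    cross (Finsupp.single I 1) (Finsupp.single P 1) =
      Finsupp.single (Fin.cons I P : ElemCube (d + 1)) 1 := by
  simp [cross]

/-- Bilinear identities between chains of intervals and chains of cubes can be checked on
generators. -/
lemma bilin_ext {d : ℕ} {M : Type} [AddCommGroup M]
    {f g : (ElemInterval →₀ ℤ) →ₗ[ℤ] (ElemCube d →₀ ℤ) →ₗ[ℤ] M}
    (h : ∀ I P, f (Finsupp.single I 1) (Finsupp.single P 1) =
      g (Finsupp.single I 1) (Finsupp.single P 1)) : f = g :=
  Finsupp.lhom_ext' fun I => LinearMap.ext_ring <|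
    Finsupp.lhom_ext' fun P => LinearMap.ext_ring (h I P)

lemma cross_ext {d : ℕ} {M : Type} [AddCommGroup M]
    {f g : (ElemCube (d + 1) →₀ ℤ) →ₗ[ℤ] M} (h : ∀ x y, f (cross x y) = g (cross x y)) :
    f = g := by
  refine Finsupp.lhom_ext' fun Q => LinearMap.ext_ring ?_
  have := h (Finsupp.single (Q 0) 1) (Finsupp.single (Fin.tail Q) 1)
  rwa [cross_single, Fin.cons_self_tail] at this

lemma cross_mem {d : ℕ} {s : Set ElemInterval} {t : Set (ElemCube d)}
    {u : Set (ElemCube (d + 1))} (h : ∀ I ∈ s, ∀ P ∈ t, (Fin.cons I P : ElemCube (d + 1)) ∈ u)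
    {x : ElemInterval →₀ ℤ} {y : ElemCube d →₀ ℤ} (hx : x ∈ Finsupp.supported ℤ ℤ s)
    (hy : y ∈ Finsupp.supported ℤ ℤ t) : cross x y ∈ Finsupp.supported ℤ ℤ u := by
  refine linearMap_mem_of_single (cross.flip y) (fun I hI => ?_) hx
  refine linearMap_mem_of_single (cross (Finsupp.single I 1)) (fun P hP => ?_) hy
  rw [cross_single]
  exact Finsupp.single_mem_supported _ _ (h I hI P hP)

lemma bd_cross {d : ℕ} (x : ElemInterval →₀ ℤ) (y : ElemCube d →₀ ℤ) :
    bd (d + 1) (cross x y) = cross (bdLin x) y + cross (sign x) (bd d y) := by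
  have h : (cross (d := d)).compr₂ (bd (d + 1)) =
      cross ∘ₗ bdLin + (cross ∘ₗ sign).compl₂ (bd d) := by
    refine bilin_ext fun I P => ?_
    simp only [LinearMap.compr₂_apply, LinearMap.add_apply, LinearMap.comp_apply,
      LinearMap.compl₂_apply, cross_single, bd_single_succ]
    obtain ⟨k, _ | _⟩ := I
    · simp [cross, ElemInterval.bd, ElemInterval.dim]
    · simp [cross, ElemInterval.bd, ElemInterval.dim, ElemInterval.point, sub_eq_add_neg,
        Finsupp.mapDomain_add, ← Finsupp.single_neg]
  exact congrArg (fun f => f x y) h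

/-- The `d`-fold tensor power of an operator on chains of intervals. -/
def powMap (f : (ElemInterval →₀ ℤ) →ₗ[ℤ] (ElemInterval →₀ ℤ)) :
    (d : ℕ) → (ElemCube d →₀ ℤ) →ₗ[ℤ] (ElemCube d →₀ ℤ)
  | 0 => LinearMap.id
  | d + 1 => Finsupp.linearCombination ℤ fun Q =>
      cross (f (Finsupp.single (Q 0) 1)) (powMap f d (Finsupp.single (Fin.tail Q) 1))

section PowMap

variable {f : (ElemInterval →₀ ℤ) →ₗ[ℤ] (ElemInterval →₀ ℤ)}

lemma powMap_cross {d : ℕ} (x : ElemInterval →₀ ℤ) (y : ElemCube d →₀ ℤ) :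
    powMap f (d + 1) (cross x y) = cross (f x) (powMap f d y) := by
  have h : (cross (d := d)).compr₂ (powMap f (d + 1)) = (cross ∘ₗ f).compl₂ (powMap f d) := by
    refine bilin_ext fun I P => ?_
    simp only [LinearMap.compr₂_apply, LinearMap.comp_apply, LinearMap.compl₂_apply, cross_single]
    simp [powMap]
  exact congrArg (fun f => f x y) h

lemma powMap_comp (f g : (ElemInterval →₀ ℤ) →ₗ[ℤ] (ElemInterval →₀ ℤ)) :
    ∀ d, powMap (f ∘ₗ g) d = powMap f d ∘ₗ powMap g d
  | 0 => rfl
  | d + 1 => cross_ext fun x y => by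
    simp only [LinearMap.comp_apply, powMap_cross, powMap_comp f g d]

lemma powMap_id : ∀ d, powMap LinearMap.id d = LinearMap.id
  | 0 => rfl
  | d + 1 => cross_ext fun x y => by simp only [powMap_cross, powMap_id d, LinearMap.id_apply]

/-- Tensor powers of degree-preserving chain maps are chain maps. -/
lemma bd_comp_powMap (hb : bdLin ∘ₗ f = f ∘ₗ bdLin) (hs : sign ∘ₗ f = f ∘ₗ sign) :
    ∀ d, bd d ∘ₗ powMap f d = powMap f d ∘ₗ bd d
  | 0 => rfl
  | d + 1 => cross_ext fun x y => by
    have hb' : bdLin (f x) = f (bdLin x) := congrArg (fun f => f x) hb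
    have hs' : sign (f x) = f (sign x) := congrArg (fun f => f x) hs
    have ih : bd d (powMap f d y) = powMap f d (bd d y) :=
      congrArg (fun f => f y) (bd_comp_powMap hb hs d)
    simp only [LinearMap.comp_apply, powMap_cross, bd_cross, map_add, hb', hs', ih]

/-- Tensor powers are local: a relation between intervals that bounds the support of `f` bounds
the support of `powMap f d` coordinatewise. -/
lemma powMap_mem {r : ElemInterval → ElemInterval → Prop}
    (hf : ∀ I, f (Finsupp.single I 1) ∈ Finsupp.supported ℤ ℤ {J | r I J}) :
    ∀ {d : ℕ} (Q : ElemCube d),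
      powMap f d (Finsupp.single Q 1) ∈ Finsupp.supported ℤ ℤ {P | ∀ i, r (Q i) (P i)}
  | 0, Q => Finsupp.single_mem_supported _ _ fun i => i.elim0
  | d + 1, Q => by
    rw [powMap, Finsupp.linearCombination_single, one_smul]
    refine cross_mem ?_ (hf (Q 0)) (powMap_mem hf (Fin.tail Q))
    intro J hJ P hP i
    refine Fin.cases ?_ (fun j => ?_) i
    · exact hJ
    · exact hP j

/-- The homotopy from `powMap f d` to the identity induced by a homotopy `h` from `f` to the
identity: `h ⊗ 1 + f ⊗ H` on `I × P`, with the Koszul sign. -/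
def powHtpy (f h : (ElemInterval →₀ ℤ) →ₗ[ℤ] (ElemInterval →₀ ℤ)) :
    (d : ℕ) → (ElemCube d →₀ ℤ) →ₗ[ℤ] (ElemCube d →₀ ℤ)
  | 0 => 0
  | d + 1 => Finsupp.linearCombination ℤ fun Q =>
      cross (h (Finsupp.single (Q 0) 1)) (Finsupp.single (Fin.tail Q) 1) +
      cross (sign (f (Finsupp.single (Q 0) 1))) (powHtpy f h d (Finsupp.single (Fin.tail Q) 1))

variable {h : (ElemInterval →₀ ℤ) →ₗ[ℤ] (ElemInterval →₀ ℤ)}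

lemma powHtpy_cross {d : ℕ} (x : ElemInterval →₀ ℤ) (y : ElemCube d →₀ ℤ) :
    powHtpy f h (d + 1) (cross x y) =
      cross (h x) y + cross (sign (f x)) (powHtpy f h d y) := by
  have e : (cross (d := d)).compr₂ (powHtpy f h (d + 1)) =
      cross ∘ₗ h + (cross ∘ₗ sign ∘ₗ f).compl₂ (powHtpy f h d) := by
    refine bilin_ext fun I P => ?_
    simp only [LinearMap.compr₂_apply, LinearMap.comp_apply, LinearMap.compl₂_apply, cross_single,
      LinearMap.add_apply]
    simp [powHtpy]
  exact congrArg (fun f => f x y) e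

lemma bd_powHtpy (hs : sign ∘ₗ f = f ∘ₗ sign)
    (hb : bdLin ∘ₗ f = f ∘ₗ bdLin) (hhs : sign ∘ₗ h = -(h ∘ₗ sign))
    (hh : bdLin ∘ₗ h + h ∘ₗ bdLin = f - LinearMap.id) :
    ∀ d, bd d ∘ₗ powHtpy f h d + powHtpy f h d ∘ₗ bd d = powMap f d - LinearMap.id
  | 0 => by simp [powHtpy, powMap]
  | d + 1 => cross_ext fun x y => by
    have hss : ∀ x, sign (sign x) = x := fun x => congrArg (fun f => f x) sign_comp_sign
    have hsb : ∀ x, sign (bdLin x) = -bdLin (sign x) :=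
      fun x => congrArg (fun f => f x) sign_comp_bdLin
    have hb' : ∀ x, bdLin (f x) = f (bdLin x) := fun x => congrArg (fun f => f x) hb
    have hs' : ∀ x, sign (f x) = f (sign x) := fun x => congrArg (fun f => f x) hs
    have hhs' : ∀ x, sign (h x) = -h (sign x) := fun x => congrArg (fun f => f x) hhs
    have hh' : bdLin (h x) = f x - x - h (bdLin x) :=
      eq_sub_of_add_eq (congrArg (fun f => f x) hh)
    have ih : bd d (powHtpy f h d y) = powMap f d y - y - powHtpy f h d (bd d y) :=
      eq_sub_of_add_eq (congrArg (fun f => f y) (bd_powHtpy hs hb hhs hh d))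
    simp only [LinearMap.comp_apply, LinearMap.add_apply, LinearMap.sub_apply, LinearMap.id_apply,
      powMap_cross, powHtpy_cross, bd_cross, map_add, hb', hs', hhs', hss, hh', ih, hsb, map_sub,
      map_neg, LinearMap.sub_apply, LinearMap.neg_apply]
    abel

/-- Tensor homotopies are local, and raise the dimension by one. -/
lemma powHtpy_mem {r : ElemInterval → ElemInterval → Prop} (hr : ∀ I, r I I)
    (hf : ∀ I, f (Finsupp.single I 1) ∈ Finsupp.supported ℤ ℤ {J | r I J ∧ J.dim = I.dim})
    (hh : ∀ I, h (Finsupp.single I 1) ∈ Finsupp.supported ℤ ℤ {J | r I J ∧ J.dim = I.dim + 1}) :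
    ∀ {d : ℕ} (Q : ElemCube d), powHtpy f h d (Finsupp.single Q 1) ∈
      Finsupp.supported ℤ ℤ {P | (∀ i, r (Q i) (P i)) ∧ P.dim = Q.dim + 1}
  | 0, Q => by simp [powHtpy]
  | d + 1, Q => by
    have hQ : Q.dim = (Q 0).dim + ElemCube.dim (Fin.tail Q) := Fin.sum_univ_succ _
    have hc : ∀ (I : ElemInterval) (P : ElemCube d),
        ElemCube.dim (Fin.cons I P : ElemCube (d + 1)) = I.dim + P.dim := fun I P => by
      simp [ElemCube.dim, Fin.sum_univ_succ]
    rw [powHtpy, Finsupp.linearCombination_single, one_smul]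
    refine Submodule.add_mem _ ?_ ?_
    · refine cross_mem (t := {Fin.tail Q}) ?_ (hh (Q 0)) (Finsupp.single_mem_supported _ _ rfl)
      rintro J hJ P rfl
      refine ⟨fun i => ?_, ?_⟩
      · refine Fin.cases hJ.1 (fun j => hr _) i
      · rw [hc, hQ, hJ.2]
        omega
    · refine cross_mem ?_ (sign_mem (hf (Q 0))) (powHtpy_mem hr hf hh (Fin.tail Q))
      intro J hJ P hP
      refine ⟨fun i => ?_, ?_⟩
      · exact Fin.cases hJ.1 hP.1 i
      · rw [hc, hQ, hJ.2, hP.2]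
        omega

end PowMap

end ElemCube

/-! ### Subdivision of intervals -/

namespace ElemInterval

/-- Subdivision of intervals: `{k} ↦ {2k}` and `[k, k + 1] ↦ [2k, 2k + 1] + [2k + 1, 2k + 2]`. -/
def subdiv : (ElemInterval →₀ ℤ) →ₗ[ℤ] (ElemInterval →₀ ℤ) :=
  Finsupp.linearCombination ℤ fun I =>
    if I.nondeg then
      Finsupp.single ⟨2 * I.lo, true⟩ 1 + Finsupp.single ⟨2 * I.lo + 1, true⟩ 1
    else Finsupp.single ⟨2 * I.lo, false⟩ 1

/-- The chain map induced by `k ↦ ⌈k / 2⌉`: it stretches `[2m, 2m + 1]` to `[m, m + 1]` and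
collapses `[2m + 1, 2m + 2]` to the point `{m + 1}`. -/
def collapse : (ElemInterval →₀ ℤ) →ₗ[ℤ] (ElemInterval →₀ ℤ) :=
  Finsupp.linearCombination ℤ fun I =>
    if I.nondeg then if I.lo % 2 = 0 then Finsupp.single ⟨I.lo / 2, true⟩ 1 else 0
    else Finsupp.single ⟨(I.lo + 1) / 2, false⟩ 1

/-- The homotopy from `subdiv ∘ collapse` to the identity: it sends the odd point `{2m + 1}` to the
interval `[2m + 1, 2m + 2]`, and all other generators to zero. -/
def htpy : (ElemInterval →₀ ℤ) →ₗ[ℤ] (ElemInterval →₀ ℤ) :=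
  Finsupp.linearCombination ℤ fun I =>
    if I.nondeg = false ∧ I.lo % 2 = 1 then Finsupp.single ⟨I.lo, true⟩ 1 else 0

@[simp] lemma subdiv_point (k : ℤ) :
    subdiv (Finsupp.single ⟨k, false⟩ 1) = Finsupp.single ⟨2 * k, false⟩ 1 := by
  simp [subdiv]

@[simp] lemma subdiv_edge (k : ℤ) : subdiv (Finsupp.single ⟨k, true⟩ 1) =
    Finsupp.single ⟨2 * k, true⟩ 1 + Finsupp.single ⟨2 * k + 1, true⟩ 1 := by
  simp [subdiv]

@[simp] lemma collapse_point_even (m : ℤ) :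
    collapse (Finsupp.single ⟨2 * m, false⟩ 1) = Finsupp.single ⟨m, false⟩ 1 := by
  have : (2 * m + 1) / 2 = m := by omega
  simp [collapse, this]

@[simp] lemma collapse_point_odd (m : ℤ) :
    collapse (Finsupp.single ⟨2 * m + 1, false⟩ 1) = Finsupp.single ⟨m + 1, false⟩ 1 := by
  have : (2 * m + 1 + 1) / 2 = m + 1 := by omega
  simp [collapse, this]

@[simp] lemma collapse_edge_even (m : ℤ) :
    collapse (Finsupp.single ⟨2 * m, true⟩ 1) = Finsupp.single ⟨m, true⟩ 1 := by
  simp [collapse]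

@[simp] lemma collapse_edge_odd (m : ℤ) :
    collapse (Finsupp.single ⟨2 * m + 1, true⟩ 1) = 0 := by
  simp [collapse]

@[simp] lemma htpy_point_even (m : ℤ) : htpy (Finsupp.single ⟨2 * m, false⟩ 1) = 0 := by
  simp [htpy]

@[simp] lemma htpy_point_odd (m : ℤ) :
    htpy (Finsupp.single ⟨2 * m + 1, false⟩ 1) = Finsupp.single ⟨2 * m + 1, true⟩ 1 := by
  simp [htpy]

@[simp] lemma htpy_edge (k : ℤ) : htpy (Finsupp.single ⟨k, true⟩ 1) = 0 := by
  simp [htpy]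

/-- Extensionality on generators with a case distinction on the parity of the left end point. -/
lemma linearMap_ext_parity {M : Type} [AddCommGroup M] {f g : (ElemInterval →₀ ℤ) →ₗ[ℤ] M}
    (h : ∀ (e : Bool) (m : ℤ),
      f (Finsupp.single ⟨2 * m, e⟩ 1) = g (Finsupp.single ⟨2 * m, e⟩ 1) ∧
      f (Finsupp.single ⟨2 * m + 1, e⟩ 1) = g (Finsupp.single ⟨2 * m + 1, e⟩ 1)) : f = g := by
  have h' : ∀ e k, f (Finsupp.single ⟨k, e⟩ 1) = g (Finsupp.single ⟨k, e⟩ 1) := fun e k => by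
    obtain ⟨m, rfl | rfl⟩ := k.even_or_odd'
    · exact (h e m).1
    · exact (h e m).2
  exact linearMap_ext (h' _) (h' _)

lemma two_mul_add_one_add_one (m : ℤ) : 2 * m + 1 + 1 = 2 * (m + 1) := by ring

lemma bdLin_comp_subdiv : bdLin ∘ₗ subdiv = subdiv ∘ₗ bdLin := by
  apply linearMap_ext <;> intro k <;> simp [two_mul_add_one_add_one]

lemma sign_comp_subdiv : sign ∘ₗ subdiv = subdiv ∘ₗ sign := by
  apply linearMap_ext <;> intro k <;> simp
  abel

lemma bdLin_comp_collapse : bdLin ∘ₗ collapse = collapse ∘ₗ bdLin := by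
  refine linearMap_ext_parity fun e m => ?_
  cases e <;> simp [two_mul_add_one_add_one]

lemma sign_comp_collapse : sign ∘ₗ collapse = collapse ∘ₗ sign := by
  refine linearMap_ext_parity fun e m => ?_
  cases e <;> simp

lemma collapse_comp_subdiv : collapse ∘ₗ subdiv = LinearMap.id := by
  apply linearMap_ext <;> intro k <;> simp

lemma sign_comp_htpy : sign ∘ₗ htpy = -(htpy ∘ₗ sign) := by
  refine linearMap_ext_parity fun e m => ?_
  cases e <;> simp

lemma bdLin_htpy : bdLin ∘ₗ htpy + htpy ∘ₗ bdLin = subdiv ∘ₗ collapse - LinearMap.id := by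
  refine linearMap_ext_parity fun e m => ?_
  cases e <;> simp [two_mul_add_one_add_one]

/-- The smallest elementary interval `I` such that `J` lies in `2 I`. -/
def carrier (J : ElemInterval) : ElemInterval := ⟨J.lo / 2, J.nondeg || decide (J.lo % 2 = 1)⟩

/-- Containment of intervals, in terms of their end points. -/
def Le (I J : ElemInterval) : Prop := J.lo ≤ I.lo ∧ I.hi ≤ J.hi

lemma Le.refl (I : ElemInterval) : I.Le I := ⟨le_rfl, le_rfl⟩

lemma subdiv_mem (I : ElemInterval) : subdiv (Finsupp.single I 1) ∈
    Finsupp.supported ℤ ℤ {J | J.carrier = I ∧ J.dim = I.dim} := by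
  obtain ⟨k, _ | _⟩ := I
  · rw [subdiv_point]
    exact Finsupp.single_mem_supported _ _ ⟨by simp [carrier], rfl⟩
  · rw [subdiv_edge]
    refine Submodule.add_mem _ (Finsupp.single_mem_supported _ _ ⟨by simp [carrier], rfl⟩)
      (Finsupp.single_mem_supported _ _ ⟨?_, rfl⟩)
    have : (2 * k + 1) / 2 = k := by omega
    simp [carrier, this]

lemma collapse_mem (J : ElemInterval) : collapse (Finsupp.single J 1) ∈
    Finsupp.supported ℤ ℤ {I | I.Le J.carrier ∧ I.dim = J.dim} := by
  rw [collapse, Finsupp.linearCombination_single, one_smul]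
  split_ifs with h h'
  · refine Finsupp.single_mem_supported _ _ ⟨?_, by simp [dim, h]⟩
    simp [carrier, Le, hi, dim, h]
  · exact Submodule.zero_mem _
  · refine Finsupp.single_mem_supported _ _ ⟨?_, by simp [dim, h]⟩
    simp only [Bool.not_eq_true] at h
    simp only [Le, hi, dim, carrier, h, Bool.false_or, decide_eq_true_eq]
    split_ifs <;> simp at * <;> omega

lemma subdiv_collapse_mem (J : ElemInterval) : (subdiv ∘ₗ collapse) (Finsupp.single J 1) ∈
    Finsupp.supported ℤ ℤ {L | L.carrier.Le J.carrier ∧ L.dim = J.dim} := by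
  refine linearMap_mem_of_single subdiv (fun I hI => ?_) (collapse_mem J)
  refine Finsupp.supported_mono ?_ (subdiv_mem I)
  rintro L ⟨rfl, hL⟩
  exact ⟨hI.1, hL.trans hI.2⟩

lemma htpy_mem (J : ElemInterval) : htpy (Finsupp.single J 1) ∈
    Finsupp.supported ℤ ℤ {L | L.carrier.Le J.carrier ∧ L.dim = J.dim + 1} := by
  rw [htpy, Finsupp.linearCombination_single, one_smul]
  split_ifs with h
  · refine Finsupp.single_mem_supported _ _ ⟨?_, by simp [dim, h.1]⟩
    simp [carrier, Le, hi, dim, h.2]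
  · exact Submodule.zero_mem _

end ElemInterval

/-! ### The homology of the doubled subdivision -/

namespace ElemCube

/-- The smallest elementary cube `Q` such that `P` lies in `2 Q`. -/
def carrier {d : ℕ} (P : ElemCube d) : ElemCube d := fun i => (P i).carrier

lemma dim_congr {d : ℕ} {P Q : ElemCube d} (h : ∀ i, (P i).dim = (Q i).dim) : P.dim = Q.dim :=
  Finset.sum_congr rfl fun i _ => h i

lemma carrier_sdCube {d : ℕ} {F G : ElemCube d} (h : F.toSet ⊆ G.toSet) :
    (sdCube F G).carrier = G := by
  funext i
  have h0 := (toSet_subset_iff _ _).1 h i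
  obtain ⟨⟨k, e⟩, hF⟩ : ∃ I, F i = I := ⟨_, rfl⟩
  obtain ⟨⟨l, e'⟩, hG⟩ : ∃ I, G i = I := ⟨_, rfl⟩
  rw [hF, hG] at h0
  simp only [carrier, ElemInterval.carrier, sdCube, doubledBarycenter, hF, hG]
  simp only [ElemInterval.hi, ElemInterval.dim] at h0 ⊢
  cases e <;> cases e' <;> simp at h0 ⊢ <;> omega

end ElemCube

namespace CubicalComplex

variable {d : ℕ} (K : CubicalComplex d)

/-- The cubes of the doubled subdivision are those elementary cubes whose carrier is in `K`. -/
lemma mem_twoSd_iff (P : ElemCube d) : P ∈ K.twoSd.cells ↔ P.carrier ∈ K.cells := by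
  constructor
  · rintro ⟨F, -, G, hG, hFG, rfl⟩
    rwa [ElemCube.carrier_sdCube hFG]
  · intro h
    -- The lower end of the interval `[F, P.carrier]` is spanned by the even end points of `P`.
    let F : ElemCube d := fun i =>
      if (P i).nondeg then ⟨((P i).lo + 1) / 2, false⟩ else (P i).carrier
    have hF : F.toSet ⊆ P.carrier.toSet := by
      rw [ElemCube.toSet_subset_iff]
      intro i
      obtain ⟨⟨k, e⟩, hP⟩ : ∃ I, P i = I := ⟨_, rfl⟩
      simp only [F, ElemCube.carrier, hP, ElemInterval.carrier]
      cases e <;> simp [ElemInterval.hi, ElemInterval.dim]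
      omega
    refine ⟨F, K.down_closed _ _ hF h, P.carrier, h, hF, ?_⟩
    funext i
    obtain ⟨⟨k, e⟩, hP⟩ : ∃ I, P i = I := ⟨_, rfl⟩
    simp only [F, ElemCube.carrier, hP, ElemInterval.carrier, ElemCube.sdCube,
      ElemCube.doubledBarycenter]
    rcases Int.emod_two_eq_zero_or_one k with h | h <;>
      cases e <;> simp [ElemInterval.hi, ElemInterval.dim, h] <;> omega

/-- A cube all of whose vertices lie in the doubled subdivision belongs to it. -/
lemma mem_twoSd_of_vertices (P : ElemCube d)
    (h : ∀ v ∈ P.vertices, v ∈ K.twoSd.vertices) : P ∈ K.twoSd.cells := by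
  -- The vertex with odd coordinates wherever possible has the same carrier as the cube.
  let v : Fin d → ℤ := fun i =>
    if (P i).nondeg = true ∧ (P i).lo % 2 = 0 then (P i).lo + 1 else (P i).lo
  have hv : v ∈ P.vertices := by
    intro i
    simp only [v, ElemInterval.hi, ElemInterval.dim]
    split_ifs <;> simp_all
  have hc : (ElemCube.point v).carrier = P.carrier := by
    funext i
    obtain ⟨⟨k, e⟩, hP⟩ : ∃ I, P i = I := ⟨_, rfl⟩
    simp only [v, ElemCube.carrier, ElemCube.point, ElemInterval.point, ElemInterval.carrier, hP]
    rcases Int.emod_two_eq_zero_or_one k with h | h <;> cases e <;> simp [h]; omega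
  rw [mem_twoSd_iff, ← hc, ← mem_twoSd_iff]
  exact h v hv

lemma bd_eq_zero_of_mem_chains_zero (c : ElemCube d →₀ ℤ) (hc : c ∈ K.chains 0) :
    ElemCube.bd d c = 0 := by
  refine (Submodule.mem_bot ℤ).1 (linearMap_mem_of_single (ElemCube.bd d) (fun Q hQ => ?_) hc)
  refine (Submodule.mem_bot ℤ).2 ?_
  have h := ElemCube.bd_mem Q
  rw [hQ.2] at h
  simpa using h

open ElemInterval ElemCube in
/-- Subdivision does not change the homology: `subdiv` and `collapse` are homotopy inverse, and all
operators involved respect carriers. -/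
lemma homology_iso_twoSd (n : ℕ) :
    Nonempty (K.chainComplex.homology n ≅ K.twoSd.chainComplex.homology n) := by
  have hle : ∀ {P Q : ElemCube d}, (∀ i, (P i).Le (Q i)) → P.toSet ⊆ Q.toSet :=
    fun h => (ElemCube.toSet_subset_iff _ _).2 h
  refine homology_iso_of_homotopy (powMap subdiv d) (powMap collapse d)
    (powHtpy (subdiv ∘ₗ collapse) htpy d) (fun n x hx => ?_)
    (fun x => congrArg (fun f => f x) (bd_comp_powMap bdLin_comp_subdiv sign_comp_subdiv d))
    (fun n x hx => ?_)
    (fun x => congrArg (fun f => f x) (bd_comp_powMap bdLin_comp_collapse sign_comp_collapse d))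
    (fun n x hx => ?_) K.twoSd.bd_eq_zero_of_mem_chains_zero (fun x => ?_) (fun y => ?_) n
  · refine linearMap_mem_of_single _ (fun Q hQ => ?_) hx
    refine Finsupp.supported_mono ?_ (powMap_mem subdiv_mem Q)
    refine fun P hP => ⟨?_, ?_⟩
    · rw [mem_twoSd_iff, show P.carrier = Q from funext fun i => (hP i).1]
      exact hQ.1
    · exact (dim_congr fun i => (hP i).2).trans hQ.2
  · refine linearMap_mem_of_single _ (fun Q hQ => ?_) hx
    refine Finsupp.supported_mono ?_ (powMap_mem collapse_mem Q)
    refine fun P hP => ⟨?_, ?_⟩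
    · exact K.down_closed _ _ (hle fun i => (hP i).1) ((K.mem_twoSd_iff Q).1 hQ.1)
    · exact (dim_congr fun i => (hP i).2).trans hQ.2
  · refine linearMap_mem_of_single _ (fun Q hQ => ?_) hx
    refine Finsupp.supported_mono ?_
      (powHtpy_mem (r := fun I J => J.carrier.Le I.carrier) (fun I => Le.refl _)
        subdiv_collapse_mem htpy_mem Q)
    refine fun P hP => ⟨?_, ?_⟩
    · rw [mem_twoSd_iff]
      exact K.down_closed _ _ (hle fun i => hP.1 i) ((K.mem_twoSd_iff Q).1 hQ.1)
    · rw [hP.2, hQ.2]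
  · have h := powMap_comp collapse subdiv d
    rw [collapse_comp_subdiv, powMap_id] at h
    exact (congrArg (fun f => f x) h).symm
  · have h := bd_powHtpy (f := subdiv ∘ₗ collapse) (h := htpy)
      (by rw [← LinearMap.comp_assoc, sign_comp_subdiv, LinearMap.comp_assoc, sign_comp_collapse,
        LinearMap.comp_assoc])
      (by rw [← LinearMap.comp_assoc, bdLin_comp_subdiv, LinearMap.comp_assoc,
        bdLin_comp_collapse, LinearMap.comp_assoc])
      sign_comp_htpy bdLin_htpy d
    rw [powMap_comp] at h
    exact congrArg (fun f => f y) h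

end CubicalComplex

/-! ### Translations -/

namespace ElemCube

/-- Translation of cubical chains. -/
def translateLin {d : ℕ} (t : Fin d → ℤ) : (ElemCube d →₀ ℤ) →ₗ[ℤ] (ElemCube d →₀ ℤ) :=
  Finsupp.lmapDomain ℤ ℤ (translate t)

lemma translateLin_single {d : ℕ} (t : Fin d → ℤ) (Q : ElemCube d) :
    translateLin t (Finsupp.single Q 1) = Finsupp.single (translate t Q) 1 := by
  simp [translateLin]

lemma translate_translate_neg {d : ℕ} (t : Fin d → ℤ) (Q : ElemCube d) :
    translate t (translate (-t) Q) = Q := by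
  funext i
  simp [translate]

lemma translate_neg_translate {d : ℕ} (t : Fin d → ℤ) (Q : ElemCube d) :
    translate (-t) (translate t Q) = Q := by
  funext i
  simp [translate]

lemma translate_cons {d : ℕ} (t : Fin (d + 1) → ℤ) (I : ElemInterval) (P : ElemCube d) :
    translate t (Fin.cons I P : ElemCube (d + 1)) =
      (Fin.cons ⟨I.lo + t 0, I.nondeg⟩ (translate (Fin.tail t) P) : ElemCube (d + 1)) := by
  funext i
  refine Fin.cases rfl (fun j => rfl) i

lemma bd_translateLin : ∀ {d : ℕ} (t : Fin d → ℤ) (c : ElemCube d →₀ ℤ),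
    bd d (translateLin t c) = translateLin t (bd d c)
  | 0, t, c => by simp [bd]
  | d + 1, t, c => by
    let f : (ElemInterval →₀ ℤ) →ₗ[ℤ] (ElemInterval →₀ ℤ) :=
      Finsupp.lmapDomain ℤ ℤ fun I => ⟨I.lo + t 0, I.nondeg⟩
    have hf : ∀ I, f (Finsupp.single I 1) = Finsupp.single ⟨I.lo + t 0, I.nondeg⟩ 1 :=
      fun I => by simp [f]
    have hc : ∀ x y, translateLin t (cross x y) = cross (f x) (translateLin (Fin.tail t) y) := by
      have h : (cross (d := d)).compr₂ (translateLin t) =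
          (cross ∘ₗ f).compl₂ (translateLin (Fin.tail t)) := by
        refine bilin_ext fun I P => ?_
        simp only [LinearMap.compr₂_apply, LinearMap.comp_apply, LinearMap.compl₂_apply,
          cross_single, hf, translateLin_single, translate_cons]
      exact fun x y => congrArg (fun f => f x y) h
    have hb : ElemInterval.bdLin ∘ₗ f = f ∘ₗ ElemInterval.bdLin := by
      apply ElemInterval.linearMap_ext <;> intro k <;> simp [hf, add_right_comm]
    have hs : ElemInterval.sign ∘ₗ f = f ∘ₗ ElemInterval.sign := by
      apply ElemInterval.linearMap_ext <;> intro k <;> simp [hf]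
    have hb' : ∀ x, ElemInterval.bdLin (f x) = f (ElemInterval.bdLin x) :=
      fun x => congrArg (fun f => f x) hb
    have hs' : ∀ x, ElemInterval.sign (f x) = f (ElemInterval.sign x) :=
      fun x => congrArg (fun f => f x) hs
    have h : bd (d + 1) ∘ₗ translateLin t = translateLin t ∘ₗ bd (d + 1) :=
      cross_ext fun x y => by
        simp only [LinearMap.comp_apply, hc, bd_cross, map_add, hb', hs', bd_translateLin]
    exact congrArg (fun f => f c) h

end ElemCube

namespace CubicalComplex

variable {d : ℕ} (K : CubicalComplex d)

lemma mem_translate_iff (t : Fin d → ℤ) (Q : ElemCube d) :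
    Q ∈ (K.translate t).cells ↔ ElemCube.translate (-t) Q ∈ K.cells := by
  constructor
  · rintro ⟨P, hP, rfl⟩
    rwa [ElemCube.translate_neg_translate]
  · exact fun h => ⟨_, h, ElemCube.translate_translate_neg t Q⟩

lemma homology_iso_translate (t : Fin d → ℤ) (n : ℕ) :
    Nonempty (K.chainComplex.homology n ≅ (K.translate t).chainComplex.homology n) := by
  have hc : ∀ s s' : Fin d → ℤ,
      (∀ Q : ElemCube d, ElemCube.translate s (ElemCube.translate s' Q) = Q) →
      ∀ x, ElemCube.translateLin s (ElemCube.translateLin s' x) = x := by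
    intro s s' h x
    have : ElemCube.translateLin s ∘ₗ ElemCube.translateLin s' = LinearMap.id :=
      Finsupp.lhom_ext' fun Q => LinearMap.ext_ring (by
        simp [ElemCube.translateLin_single, h])
    exact congrArg (fun f => f x) this
  refine homology_iso_of_homotopy (ElemCube.translateLin t) (ElemCube.translateLin (-t)) 0
    (fun n x hx => ?_) (ElemCube.bd_translateLin t) (fun n x hx => ?_)
    (ElemCube.bd_translateLin (-t)) (fun n x hx => Submodule.zero_mem _)
    (K.translate t).bd_eq_zero_of_mem_chains_zero
    (hc _ _ fun Q => ElemCube.translate_neg_translate t Q) (fun y => ?_) n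
  · refine linearMap_mem_of_single _ (fun Q hQ => ?_) hx
    rw [ElemCube.translateLin_single]
    exact Finsupp.single_mem_supported _ _ ⟨⟨Q, hQ.1, rfl⟩, hQ.2⟩
  · refine linearMap_mem_of_single _ (fun Q hQ => ?_) hx
    rw [ElemCube.translateLin_single]
    exact Finsupp.single_mem_supported _ _ ⟨(K.mem_translate_iff t Q).1 hQ.1, hQ.2⟩
  · simp [hc _ _ fun Q => ElemCube.translate_translate_neg t Q]

end CubicalComplex

/-! ### Words of lattice points -/

lemma cubeWord_zero (v : Fin 0 → ℕ) : cubeWord v = [] := by simp [cubeWord]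

lemma cubeWord_succ {d : ℕ} (v : Fin (d + 1) → ℕ) :
    cubeWord v = AB.a :: (List.replicate (v 0) AB.b ++ cubeWord (Fin.tail v)) := by
  simp [cubeWord, List.ofFn_succ, Fin.tail]

lemma cubeWord_ne_b {d : ℕ} (v : Fin d → ℕ) (w : List AB) : cubeWord v ≠ AB.b :: w := by
  cases d with
  | zero => simp [cubeWord_zero]
  | succ d => simp [cubeWord_succ]

lemma replicate_b_append_inj {w w' : List AB} (hw : ∀ x, w ≠ AB.b :: x)
    (hw' : ∀ x, w' ≠ AB.b :: x) : ∀ {m m' : ℕ},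
    List.replicate m AB.b ++ w = List.replicate m' AB.b ++ w' → m = m' ∧ w = w'
  | 0, 0, h => ⟨rfl, h⟩
  | 0, m' + 1, h => (hw _ h).elim
  | m + 1, 0, h => (hw' _ h.symm).elim
  | m + 1, m' + 1, h => by
    have := replicate_b_append_inj hw hw' (List.cons.inj h).2
    exact ⟨congrArg _ this.1, this.2⟩

lemma cubeWord_injective : ∀ d, Function.Injective (cubeWord (d := d))
  | 0, v, v', _ => funext fun i => i.elim0
  | d + 1, v, v', h => by
    rw [cubeWord_succ, cubeWord_succ] at h
    obtain ⟨h0, h1⟩ := replicate_b_append_inj (cubeWord_ne_b _) (cubeWord_ne_b _)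
      (List.cons.inj h).2
    funext i
    exact Fin.cases h0 (fun j => congrFun (cubeWord_injective d h1) j) i

/-- The number of letters `a` in a word. -/
def countA : List AB → ℕ
  | [] => 0
  | AB.a :: w => countA w + 1
  | AB.b :: w => countA w

lemma countA_replicate_append (w : List AB) :
    ∀ m : ℕ, countA (List.replicate m AB.b ++ w) = countA w
  | 0 => rfl
  | m + 1 => countA_replicate_append w m

lemma countA_cubeWord : ∀ {d : ℕ} (v : Fin d → ℕ), countA (cubeWord v) = d
  | 0, v => by rw [cubeWord_zero]; rfl
  | d + 1, v => by
    rw [cubeWord_succ, countA, countA_replicate_append, countA_cubeWord]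

/-! ### Blocks of elementary cubes -/

open BlockSym RawBlock

/-- The initial part `a ξ` of the block of a cube that belongs to its first factor `I`, followed
by `σ`. -/
def factorBlock (I : ElemInterval) (σ : RawBlock AB) : RawBlock AB :=
  letter AB.a :: (List.replicate I.lo.toNat (letter AB.b) ++
    ((if I.nondeg then [edge AB.b] else []) ++ σ))

lemma cubeBlock_zero (Q : ElemCube 0) : cubeBlock Q = [] := by simp [cubeBlock]

lemma cubeBlock_succ {d : ℕ} (Q : ElemCube (d + 1)) :
    cubeBlock Q = factorBlock (Q 0) (cubeBlock (Fin.tail Q)) := by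
  simp [cubeBlock, factorBlock, List.ofFn_succ, Fin.tail]
  rfl

lemma dim_replicate_append (σ : RawBlock AB) :
    ∀ m : ℕ, RawBlock.dim (List.replicate m (letter AB.b) ++ σ) = σ.dim
  | 0 => rfl
  | m + 1 => dim_replicate_append σ m

lemma dim_cubeBlock : ∀ {d : ℕ} (Q : ElemCube d), (cubeBlock Q).dim = Q.dim
  | 0, Q => by simp [cubeBlock_zero, RawBlock.dim, ElemCube.dim]
  | d + 1, Q => by
    have hQ : Q.dim = (Q 0).dim + ElemCube.dim (Fin.tail Q) := Fin.sum_univ_succ _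
    rw [cubeBlock_succ, factorBlock, RawBlock.dim, dim_replicate_append, RawBlock.dim_append,
      dim_cubeBlock, hQ, ElemInterval.dim]
    split <;> rfl

section Valid

lemma nondegenerate_letter (x : AB) {σ : RawBlock AB} (h : Nondegenerate σ) :
    Nondegenerate (letter x :: σ) := by
  cases σ with
  | nil => simp [Nondegenerate]
  | cons y σ => exact List.IsChain.cons_cons (by simp) h

lemma canonical_and_nondegenerate_cubeBlock : ∀ {d : ℕ} (Q : ElemCube d),
    Canonical (cubeBlock Q) ∧ Nondegenerate (cubeBlock Q)
  | 0, Q => by simp [cubeBlock_zero, Canonical, Nondegenerate]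
  | d + 1, Q => by
    have hr : ∀ (σ : RawBlock AB), Canonical σ ∧ Nondegenerate σ → ∀ m : ℕ,
        Canonical (List.replicate m (letter AB.b) ++ σ) ∧
        Nondegenerate (List.replicate m (letter AB.b) ++ σ) := by
      intro σ h m
      induction m with
      | zero => exact h
      | succ m ih => exact ⟨canonical_letter _ ih.1, nondegenerate_letter _ ih.2⟩
    have ih := canonical_and_nondegenerate_cubeBlock (Fin.tail Q)
    rw [cubeBlock_succ, factorBlock]
    suffices h : Canonical ((if (Q 0).nondeg then [edge AB.b] else []) ++
          cubeBlock (Fin.tail Q)) ∧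
        Nondegenerate ((if (Q 0).nondeg then [edge AB.b] else []) ++ cubeBlock (Fin.tail Q)) by
      have := hr _ h (Q 0).lo.toNat
      exact ⟨canonical_letter _ this.1, nondegenerate_letter _ this.2⟩
    split
    · cases d with
      | zero => simp [cubeBlock_zero, Canonical, Nondegenerate]
      | succ d =>
        rw [cubeBlock_succ, factorBlock] at ih ⊢
        exact ⟨List.IsChain.cons_cons (by rintro _ ⟨⟩; simp) ih.1,
          List.IsChain.cons_cons (by simp) ih.2⟩
    · exact ih

lemma isValid_cubeBlock {d : ℕ} (Q : ElemCube d) : (Block.mk (cubeBlock Q)).IsValid :=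
  ⟨_, rfl, canonical_and_nondegenerate_cubeBlock Q⟩

end Valid

section Boundary

lemma rawBd_replicate_append (σ : RawBlock AB) : ∀ m : ℕ,
    rawBd (List.replicate m (letter AB.b) ++ σ) =
      Finsupp.lmapDomain ℤ ℤ (List.replicate m (letter AB.b) ++ ·) (rawBd σ)
  | 0 => Finsupp.mapDomain_id.symm
  | m + 1 => by
    rw [List.replicate_succ, List.cons_append, rawBd_letter, rawBd_replicate_append σ m]
    simp only [Finsupp.lmapDomain_apply, ← Finsupp.mapDomain_comp]
    rfl

lemma rawBd_factorBlock_point (k : ℤ) (σ : RawBlock AB) :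
    rawBd (factorBlock ⟨k, false⟩ σ) =
      Finsupp.mapDomain (factorBlock ⟨k, false⟩) (rawBd σ) := by
  rw [factorBlock, rawBd_letter, rawBd_replicate_append]
  simp only [Finsupp.lmapDomain_apply, ← Finsupp.mapDomain_comp]
  rfl

lemma rawBd_factorBlock_edge {k : ℤ} (hk : 0 ≤ k) (σ : RawBlock AB) :
    rawBd (factorBlock ⟨k, true⟩ σ) =
      Finsupp.single (factorBlock ⟨k + 1, false⟩ σ) 1 -
        Finsupp.single (factorBlock ⟨k, false⟩ σ) 1 -
        Finsupp.mapDomain (factorBlock ⟨k, true⟩) (rawBd σ) := by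
  have e : (k + 1).toNat = k.toNat + 1 := by omega
  have h : factorBlock ⟨k + 1, false⟩ σ =
      letter AB.a :: (List.replicate k.toNat (letter AB.b) ++ letter AB.b :: σ) := by
    simp [factorBlock, e, List.replicate_succ']
  rw [h, factorBlock, rawBd_letter, rawBd_replicate_append]
  simp only [if_true, List.cons_append, List.nil_append, rawBd_edge, map_sub]
  simp only [Finsupp.lmapDomain_apply, Finsupp.mapDomain_single, ← Finsupp.mapDomain_comp]
  rfl

/-- On cubes with nonnegative coordinates, `cubeBlock` commutes with the boundary, even before
blocks are identified up to equivalence. -/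
lemma rawBd_cubeBlock : ∀ {d : ℕ} (Q : ElemCube d), (∀ i, 0 ≤ (Q i).lo) →
    rawBd (cubeBlock Q) =
      Finsupp.lmapDomain ℤ ℤ cubeBlock (ElemCube.bd d (Finsupp.single Q 1))
  | 0, Q, _ => by simp [cubeBlock_zero, rawBd, RawBlock.dim, ElemCube.bd]
  | d + 1, Q, hQ => by
    obtain ⟨I, P, rfl⟩ : ∃ I P, Q = (Fin.cons I P : ElemCube (d + 1)) :=
      ⟨Q 0, Fin.tail Q, (Fin.cons_self_tail Q).symm⟩
    have ih := rawBd_cubeBlock P fun i => hQ i.succ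
    have hc : ∀ (J : ElemInterval) (R : ElemCube d),
        cubeBlock (Fin.cons J R : ElemCube (d + 1)) = factorBlock J (cubeBlock R) :=
      fun J R => cubeBlock_succ _
    have hm : ∀ (J : ElemInterval) (c : ElemCube d →₀ ℤ),
        Finsupp.mapDomain cubeBlock
          (Finsupp.mapDomain (fun R => (Fin.cons J R : ElemCube (d + 1))) c) =
        Finsupp.mapDomain (factorBlock J) (Finsupp.mapDomain cubeBlock c) := by
      intro J c
      rw [← Finsupp.mapDomain_comp, ← Finsupp.mapDomain_comp]
      exact congrArg (fun f => Finsupp.mapDomain f c) (funext fun R => hc J R)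
    rw [ElemCube.bd_single_succ, hc, map_add, map_smul]
    obtain ⟨k, _ | _⟩ := I
    · rw [rawBd_factorBlock_point, ih]
      simp [ElemInterval.bd, ElemInterval.dim, hm]
    · have hk : 0 ≤ k := hQ 0
      rw [rawBd_factorBlock_edge hk, ih]
      simp only [ElemInterval.bd, ElemInterval.dim, if_true, map_sub, Finsupp.lmapDomain_apply,
        Finsupp.mapDomain_single, hc, hm, pow_one, neg_smul, one_smul, ElemInterval.point]
      exact sub_eq_add_neg _ _

/-- The boundary of a block, computed on a representing sequence of letters and edges. -/
lemma bd_single_mk (σ : RawBlock AB) : Block.bd (Finsupp.single (Block.mk σ) 1) =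
    Finsupp.linearCombination ℤ (fun τ => Block.gen (Block.mk τ)) (rawBd σ) := by
  simp only [Block.bd_single, rawBd, map_sum, map_smul, map_sub, Block.facet_mk, Block.dim_mk,
    Finsupp.linearCombination_single, one_smul]

/-- The linear extension of `cubeBlock` to chains. -/
def blockLin (d : ℕ) : (ElemCube d →₀ ℤ) →ₗ[ℤ] (Block AB →₀ ℤ) :=
  Finsupp.lmapDomain ℤ ℤ fun Q => Block.mk (cubeBlock Q)

lemma blockLin_single {d : ℕ} (Q : ElemCube d) :
    blockLin d (Finsupp.single Q 1) = Finsupp.single (Block.mk (cubeBlock Q)) 1 := by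
  simp [blockLin]

lemma bd_blockLin_single {d : ℕ} (Q : ElemCube d) (hQ : ∀ i, 0 ≤ (Q i).lo) :
    Block.bd (blockLin d (Finsupp.single Q 1)) =
      blockLin d (ElemCube.bd d (Finsupp.single Q 1)) := by
  have h : Finsupp.linearCombination ℤ (fun τ => Block.gen (Block.mk τ)) ∘ₗ
      Finsupp.lmapDomain ℤ ℤ cubeBlock = blockLin d := by
    refine Finsupp.lhom_ext' fun P => LinearMap.ext_ring ?_
    simp [blockLin, Block.gen, isValid_cubeBlock]
  rw [blockLin_single, bd_single_mk, rawBd_cubeBlock Q hQ, ← h]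
  rfl

end Boundary

section Vertices

lemma vertex_replicate_append (σ : RawBlock AB) (J : ℕ → Bool) : ∀ m : ℕ,
    vertex (List.replicate m (letter AB.b) ++ σ) J = List.replicate m AB.b ++ vertex σ J
  | 0 => rfl
  | m + 1 => congrArg (AB.b :: ·) (vertex_replicate_append σ J m)

lemma vertex_factorBlock_point (k : ℤ) (σ : RawBlock AB) (J : ℕ → Bool) :
    vertex (factorBlock ⟨k, false⟩ σ) J =
      AB.a :: (List.replicate k.toNat AB.b ++ vertex σ J) := by
  rw [factorBlock, vertex, vertex_replicate_append]
  rfl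

lemma vertex_factorBlock_edge {k : ℤ} (hk : 0 ≤ k) (σ : RawBlock AB) (J : ℕ → Bool) :
    vertex (factorBlock ⟨k, true⟩ σ) J =
      AB.a :: (List.replicate (if J 0 then k + 1 else k).toNat AB.b ++
        vertex σ (fun n => J (n + 1))) := by
  have e : (k + 1).toNat = k.toNat + 1 := by omega
  rw [factorBlock, vertex, vertex_replicate_append]
  cases h : J 0 <;> simp [vertex, h, e, List.replicate_succ']

/-- The word of a lattice point, with negative coordinates replaced by `0`. -/
def pointWord {d : ℕ} (v : Fin d → ℤ) : List AB := cubeWord fun i => (v i).toNat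

lemma pointWord_succ {d : ℕ} (v : Fin (d + 1) → ℤ) :
    pointWord v = AB.a :: (List.replicate (v 0).toNat AB.b ++ pointWord (Fin.tail v)) :=
  cubeWord_succ _

lemma pointWord_injOn {d : ℕ} : Set.InjOn (pointWord (d := d)) {v | ∀ i, 0 ≤ v i} := by
  intro v hv w hw h
  funext i
  have h' : (v i).toNat = (w i).toNat := congrFun (cubeWord_injective d h) i
  have h1 : 0 ≤ v i := hv i
  have h2 : 0 ≤ w i := hw i
  omega

lemma ElemCube.cons_mem_vertices {d : ℕ} {Q : ElemCube (d + 1)} {k : ℤ} {v : Fin d → ℤ} :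
    (Fin.cons k v : Fin (d + 1) → ℤ) ∈ Q.vertices ↔
      (k = (Q 0).lo ∨ k = (Q 0).hi) ∧ v ∈ ElemCube.vertices (Fin.tail Q) :=
  Fin.forall_fin_succ

lemma vertices_cubeBlock : ∀ {d : ℕ} (Q : ElemCube d), (∀ i, 0 ≤ (Q i).lo) →
    (Block.mk (cubeBlock Q)).vertices = pointWord '' Q.vertices
  | 0, Q, _ => by
    change Set.range (vertex (cubeBlock Q)) = _
    ext w
    constructor
    · rintro ⟨J, rfl⟩
      exact ⟨fun i => i.elim0, fun i => i.elim0, by rw [cubeBlock_zero]; exact cubeWord_zero _⟩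
    · rintro ⟨v, -, rfl⟩
      exact ⟨fun _ => true, by rw [cubeBlock_zero]; exact (cubeWord_zero _).symm⟩
  | d + 1, Q, hQ => by
    have ih : Set.range (vertex (cubeBlock (Fin.tail Q))) = _ :=
      vertices_cubeBlock (Fin.tail Q) fun i => hQ i.succ
    have h0 := hQ 0
    have key : ∀ (k : ℤ) (v : Fin d → ℤ), pointWord (Fin.cons k v : Fin (d + 1) → ℤ) =
        AB.a :: (List.replicate k.toNat AB.b ++ pointWord v) := fun k v => pointWord_succ _
    change Set.range (vertex (cubeBlock Q)) = _
    rw [cubeBlock_succ]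
    obtain ⟨⟨k, e⟩, hI⟩ : ∃ I, Q 0 = I := ⟨_, rfl⟩
    rw [hI] at h0 ⊢
    ext w
    constructor
    · rintro ⟨J, rfl⟩
      cases e with
      | false =>
        obtain ⟨v, hv, hv'⟩ := ih.subset ⟨J, rfl⟩
        refine ⟨Fin.cons k v, ElemCube.cons_mem_vertices.2 ⟨Or.inl (by rw [hI]), hv⟩, ?_⟩
        rw [key, hv', vertex_factorBlock_point]
      | true =>
        obtain ⟨v, hv, hv'⟩ := ih.subset ⟨fun n => J (n + 1), rfl⟩
        refine ⟨Fin.cons (if J 0 then k + 1 else k) v,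
          ElemCube.cons_mem_vertices.2 ⟨?_, hv⟩, ?_⟩
        · rw [hI]
          cases J 0 <;> simp [ElemInterval.hi, ElemInterval.dim]
        · rw [key, hv', vertex_factorBlock_edge h0]
    · rintro ⟨v, hv, rfl⟩
      obtain ⟨l, v, rfl⟩ : ∃ l v', v = (Fin.cons l v' : Fin (d + 1) → ℤ) :=
        ⟨v 0, Fin.tail v, (Fin.cons_self_tail v).symm⟩
      obtain ⟨hl, hv⟩ := ElemCube.cons_mem_vertices.1 hv
      obtain ⟨J, hJ⟩ := ih.superset ⟨v, hv, rfl⟩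
      rw [hI] at hl
      cases e with
      | false =>
        obtain rfl : l = k := by simpa [ElemInterval.hi, ElemInterval.dim] using hl
        exact ⟨J, by rw [key, vertex_factorBlock_point, hJ]⟩
      | true =>
        refine ⟨ins 0 (decide (l = k + 1)) J, ?_⟩
        rw [key, vertex_factorBlock_edge h0, ins_zero_zero, ins_zero_shift, hJ]
        rcases hl with rfl | rfl <;> simp [ElemInterval.hi, ElemInterval.dim]

lemma ElemCube.eq_of_vertices_eq {d : ℕ} {P Q : ElemCube d} (h : P.vertices = Q.vertices) :
    P = Q := by
  have hlo : ∀ R : ElemCube d, (fun i => (R i).lo) ∈ R.vertices := fun R i => Or.inl rfl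
  have hhi : ∀ R : ElemCube d, (fun i => (R i).hi) ∈ R.vertices := fun R i => Or.inr rfl
  funext i
  have h1 := h.subset (hlo P) i
  have h2 := h.subset (hhi P) i
  have h3 := h.superset (hlo Q) i
  have h4 := h.superset (hhi Q) i
  have := (P i).lo_le_hi
  have := (Q i).lo_le_hi
  exact ElemInterval.ext_hi (by omega) (by omega)

lemma countA_vertex_le : ∀ σ : RawBlock AB,
    countA (vertex σ fun _ => false) ≤ countA (vertex σ fun _ => true)
  | [] => le_rfl
  | letter AB.a :: σ => Nat.succ_le_succ (countA_vertex_le σ)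
  | letter AB.b :: σ => countA_vertex_le σ
  | edge AB.a :: σ => (countA_vertex_le σ).trans (Nat.le_succ _)
  | edge AB.b :: σ => countA_vertex_le σ

lemma countA_vertex_lt : ∀ {σ : RawBlock AB}, edge AB.a ∈ σ →
    countA (vertex σ fun _ => false) < countA (vertex σ fun _ => true)
  | letter AB.a :: σ, h => Nat.succ_lt_succ (countA_vertex_lt (by simpa using h))
  | letter AB.b :: σ, h => countA_vertex_lt (σ := σ) (by simpa using h)
  | edge AB.a :: σ, _ => Nat.lt_succ_of_le (countA_vertex_le σ)
  | edge AB.b :: σ, h => countA_vertex_lt (σ := σ) (by simpa using h)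

/-- A valid block in canonical form without edges `(1, a)` is the block of a cube, up to an
initial part `b^m` or `b^m (1, b)`. -/
lemma exists_eq_append_cubeBlock : ∀ σ : RawBlock AB, Canonical σ → Nondegenerate σ →
    edge AB.a ∉ σ → ∃ (m : ℕ) (e : Bool) (k : ℕ) (Q : ElemCube k), (∀ i, 0 ≤ (Q i).lo) ∧
      σ = List.replicate m (letter AB.b) ++ ((if e then [edge AB.b] else []) ++ cubeBlock Q)
  | [], _, _, _ => ⟨0, false, 0, fun i => i.elim0, fun i => i.elim0, by simp [cubeBlock_zero]⟩
  | letter AB.a :: σ, h1, h2, h3 => by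
    obtain ⟨m, e, k, Q, hQ, rfl⟩ :=
      exists_eq_append_cubeBlock σ h1.tail h2.tail fun h => h3 (List.mem_cons_of_mem _ h)
    refine ⟨0, false, k + 1, (Fin.cons ⟨m, e⟩ Q : ElemCube (k + 1)), fun i => ?_, ?_⟩
    · exact Fin.cases (Int.natCast_nonneg m) hQ i
    · rw [cubeBlock_succ]
      simp [factorBlock]
  | letter AB.b :: σ, h1, h2, h3 => by
    obtain ⟨m, e, k, Q, hQ, rfl⟩ :=
      exists_eq_append_cubeBlock σ h1.tail h2.tail fun h => h3 (List.mem_cons_of_mem _ h)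
    exact ⟨m + 1, e, k, Q, hQ, rfl⟩
  | edge AB.a :: σ, _, _, h3 => (h3 List.mem_cons_self).elim
  | edge AB.b :: σ, h1, h2, h3 => by
    obtain ⟨m, e, k, Q, hQ, rfl⟩ :=
      exists_eq_append_cubeBlock σ h1.tail h2.tail fun h => h3 (List.mem_cons_of_mem _ h)
    cases m with
    | succ m => exact ((List.isChain_cons_cons.1 h1).1 AB.b rfl rfl).elim
    | zero =>
      cases e with
      | true => exact ((List.isChain_cons_cons.1 h2).1 AB.b rfl rfl).elim
      | false => exact ⟨0, true, k, Q, hQ, rfl⟩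

/-- A valid block in canonical form, all of whose vertices are words of lattice points, is the
block of an elementary cube. -/
lemma exists_eq_cubeBlock {d : ℕ} {σ : RawBlock AB} (h1 : Canonical σ) (h2 : Nondegenerate σ)
    (h3 : ∀ J, ∃ v : Fin d → ℕ, vertex σ J = cubeWord v) :
    ∃ Q : ElemCube d, (∀ i, 0 ≤ (Q i).lo) ∧ σ = cubeBlock Q := by
  have hc : ∀ J, countA (vertex σ J) = d := fun J => by
    obtain ⟨v, hv⟩ := h3 J
    rw [hv, countA_cubeWord]
  obtain ⟨m, e, k, Q, hQ, rfl⟩ := exists_eq_append_cubeBlock σ h1 h2 fun h => by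
    have := countA_vertex_lt h
    rw [hc, hc] at this
    exact this.false
  -- No vertex starts with the letter `b`, so the initial part is empty.
  obtain ⟨v, hv⟩ := h3 fun _ => true
  cases m with
  | succ m => exact (cubeWord_ne_b v _ hv.symm).elim
  | zero =>
    cases e with
    | true => exact (cubeWord_ne_b v _ hv.symm).elim
    | false =>
      obtain ⟨w, -, hw⟩ := (vertices_cubeBlock Q hQ).subset ⟨fun _ => true, rfl⟩
      have h : countA (vertex (cubeBlock Q) fun _ => true) = d := hc _
      obtain rfl : k = d := by rw [← h, ← hw, pointWord, countA_cubeWord]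
      exact ⟨Q, hQ, rfl⟩

end Vertices

/-! ### The isomorphism of chain complexes -/

namespace CubicalComplex

variable {d : ℕ} {K : CubicalComplex d}

lemma vertices_subset {Q : ElemCube d} (hQ : Q ∈ K.cells) : Q.vertices ⊆ K.vertices := by
  intro v hv
  refine K.down_closed _ _ ((ElemCube.toSet_subset_iff _ _).2 fun i => ?_) hQ
  have := (Q i).lo_le_hi
  have := hv i
  simp only [ElemCube.point, ElemInterval.point, ElemInterval.hi, ElemInterval.dim,
    Bool.false_eq_true, if_false] at *
  omega

lemma IsNonneg.lo_nonneg (hK : K.IsNonneg) {Q : ElemCube d} (hQ : Q ∈ K.cells) (i : Fin d) :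
    0 ≤ (Q i).lo :=
  hK (fun i => (Q i).lo) (vertices_subset hQ fun _ => Or.inl rfl) i

lemma IsNonneg.words_eq (hK : K.IsNonneg) : K.words = pointWord '' K.vertices := by
  ext w
  constructor
  · rintro ⟨m, hm, rfl⟩
    exact ⟨_, hm, rfl⟩
  · rintro ⟨v, hv, rfl⟩
    refine ⟨fun i => (v i).toNat, ?_, rfl⟩
    have : (fun i => ((v i).toNat : ℤ)) = v := funext fun i => Int.toNat_of_nonneg (hK v hv i)
    change _ ∈ K.vertices
    rwa [this]

/-- If `K` contains each elementary cube whose vertices are in `K`, the blocks of the cubes of `K`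
are the blocks with vertices in the words of `K`. -/
lemma IsNonneg.image_cubeBlock (hK : K.IsNonneg)
    (hfull : ∀ P : ElemCube d, P.vertices ⊆ K.vertices → P ∈ K.cells) (n : ℕ) :
    (fun Q => Block.mk (cubeBlock Q)) '' {Q | Q ∈ K.cells ∧ Q.dim = n} =
      {q | q ∈ insertionBlocks K.words ∧ q.dim = n} := by
  ext q
  constructor
  · rintro ⟨Q, ⟨hQ, rfl⟩, rfl⟩
    refine ⟨⟨isValid_cubeBlock Q, ?_⟩, dim_cubeBlock Q⟩
    rw [vertices_cubeBlock Q (hK.lo_nonneg hQ), hK.words_eq]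
    exact Set.image_mono (vertices_subset hQ)
  · rintro ⟨⟨⟨σ, rfl, h1, h2⟩, h3⟩, rfl⟩
    obtain ⟨Q, hQ, rfl⟩ := exists_eq_cubeBlock (d := d) h1 h2 fun J => by
      obtain ⟨m, -, hm⟩ := h3 ⟨J, rfl⟩
      exact ⟨m, hm.symm⟩
    refine ⟨Q, ⟨hfull Q fun v hv => ?_, (dim_cubeBlock Q).symm⟩, rfl⟩
    rw [vertices_cubeBlock Q hQ, hK.words_eq] at h3
    obtain ⟨w, hw, hvw⟩ := h3 ⟨v, hv, rfl⟩
    have hv0 : ∀ i, 0 ≤ v i := fun i => by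
      have := hv i
      have := hQ i
      have := (Q i).lo_le_hi
      omega
    rwa [← pointWord_injOn (hK w hw) hv0 hvw]

/-- For a cubical complex in the nonnegative orthant that contains each elementary cube whose
vertices it contains, `cubeBlock` induces an isomorphism of chain complexes. -/
lemma IsNonneg.exists_iso (hK : K.IsNonneg)
    (hfull : ∀ P : ElemCube d, P.vertices ⊆ K.vertices → P ∈ K.cells) :
    ∃ Φ : K.chainComplex ≅ insertionComplex K.words,
      ∀ (Q : ElemCube d) (hQ : Q ∈ K.cells),
        insertionComplexIncl K.words Q.dim ((Φ.hom.f Q.dim).hom (K.cube Q hQ)) =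
          Finsupp.single (Block.mk (cubeBlock Q)) 1 := by
  have himage : ∀ n, (K.chains n).map (blockLin d) = insertionChains K.words n := fun n => by
    rw [insertionChains, ← hK.image_cubeBlock hfull n]
    exact Finsupp.lmapDomain_supported _ _ _ _
  have hf : ∀ n, ∀ x ∈ K.chains n, blockLin d x ∈ insertionChains K.words n := fun n x hx =>
    himage n ▸ Submodule.mem_map_of_mem hx
  have hc : ∀ n, ∀ x ∈ K.chains n, Block.bd (blockLin d x) = blockLin d (ElemCube.bd d x) :=
    fun n x hx => sub_eq_zero.1 <| (Submodule.mem_bot ℤ).1 <|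
      linearMap_mem_of_single (Block.bd ∘ₗ blockLin d - blockLin d ∘ₗ ElemCube.bd d)
        (fun Q hQ => (Submodule.mem_bot ℤ).2 <|
          sub_eq_zero.2 (bd_blockLin_single Q (hK.lo_nonneg hQ.1))) hx
  have hinj : Set.InjOn (fun Q : ElemCube d => Block.mk (cubeBlock Q)) K.cells := by
    intro P hP Q hQ h
    have hP0 := hK.lo_nonneg hP
    have hQ0 := hK.lo_nonneg hQ
    have hnn : ∀ {R : ElemCube d}, R ∈ K.cells → R.vertices ⊆ {v | ∀ i, 0 ≤ v i} :=
      fun hR => (vertices_subset hR).trans fun v hv => hK v hv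
    refine ElemCube.eq_of_vertices_eq
      ((pointWord_injOn.image_eq_image_iff (hnn hP) (hnn hQ)).1 ?_)
    rw [← vertices_cubeBlock P hP0, ← vertices_cubeBlock Q hQ0]
    exact congrArg Block.vertices h
  let F : K.chainComplex ⟶ insertionComplex K.words := gradedMap (blockLin d) hf hc
  have hF : IsIso F := isIso_gradedMap (blockLin d) hf hc
    (fun n x hx y hy h => Finsupp.mapDomain_injOn K.cells hinj (fun Q hQ => (hx hQ).1)
      (fun Q hQ => (hy hQ).1) h)
    (fun n y hy => by rwa [← himage n] at hy)
  exact ⟨asIso F, fun Q hQ => blockLin_single Q⟩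

end CubicalComplex

/-! ### Finiteness, and translates of the doubled subdivision -/

namespace CubicalComplex

variable {d : ℕ} {K : CubicalComplex d}

lemma finite_cells_twoSd (hK : K.cells.Finite) : K.twoSd.cells.Finite :=
  (Set.Finite.image2 ElemCube.sdCube hK hK).subset <| by
    rintro _ ⟨F, hF, G, hG, -, rfl⟩
    exact ⟨F, hF, G, hG, rfl⟩

lemma finite_vertices (hK : K.cells.Finite) : K.vertices.Finite :=
  hK.preimage fun _ _ _ _ h => funext fun i => congrArg ElemInterval.lo (congrFun h i)

lemma mem_vertices_translate_iff (t v : Fin d → ℤ) :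
    v ∈ (K.translate t).vertices ↔ v - t ∈ K.vertices := by
  rw [sub_eq_add_neg]
  exact K.mem_translate_iff t (ElemCube.point v)

lemma exists_isNonneg_translate (hK : K.cells.Finite) :
    ∃ t : Fin d → ℤ, (K.translate t).IsNonneg := by
  obtain ⟨s, hs⟩ := (finite_vertices hK).bddBelow
  refine ⟨-s, fun v hv i => ?_⟩
  have := hs ((mem_vertices_translate_iff _ _).1 hv) i
  simp only [Pi.sub_apply, Pi.neg_apply] at this
  omega

/-- Translates of a doubled subdivision contain each elementary cube whose vertices they
contain. -/
lemma mem_translate_twoSd_of_vertices (t : Fin d → ℤ) (P : ElemCube d)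
    (h : P.vertices ⊆ (K.twoSd.translate t).vertices) : P ∈ (K.twoSd.translate t).cells := by
  rw [mem_translate_iff]
  refine K.mem_twoSd_of_vertices _ fun v hv => ?_
  have hv' : v + t ∈ P.vertices := fun i => by
    have h : v i = (P i).lo + -t i ∨ v i = (P i).lo + -t i + (P i).dim := hv i
    change v i + t i = (P i).lo ∨ v i + t i = (P i).lo + (P i).dim
    omega
  simpa using (mem_vertices_translate_iff t _).1 (h hv')

end CubicalComplex
end InsertionChain

end

theorem mainTheorem5 (d : ℕ) (K : InsertionChain.CubicalComplex d) (hK : K.cells.Finite) :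
    (∃ W : Set (List InsertionChain.AB), W.Finite ∧
      ∀ n : ℕ, Nonempty
        (K.chainComplex.homology n ≅ (InsertionChain.insertionComplex W).homology n)) ∧
    (∃ t : Fin d → ℤ, (K.twoSd.translate t).IsNonneg) ∧
    ∀ t : Fin d → ℤ, (K.twoSd.translate t).IsNonneg →
      (K.twoSd.translate t).words.Finite ∧
      (∀ n : ℕ, Nonempty (K.chainComplex.homology n ≅
        (InsertionChain.insertionComplex (K.twoSd.translate t).words).homology n)) ∧
      ∃ Φ : (K.twoSd.translate t).chainComplex ≅
          InsertionChain.insertionComplex (K.twoSd.translate t).words,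
        ∀ (Q : InsertionChain.ElemCube d) (hQ : Q ∈ (K.twoSd.translate t).cells),
          InsertionChain.insertionComplexIncl (K.twoSd.translate t).words Q.dim
              ((Φ.hom.f Q.dim).hom ((K.twoSd.translate t).cube Q hQ)) =
            Finsupp.single (InsertionChain.Block.mk (InsertionChain.cubeBlock Q)) 1 := by
  have main : ∀ t : Fin d → ℤ, (K.twoSd.translate t).IsNonneg →
      (K.twoSd.translate t).words.Finite ∧
      (∀ n : ℕ, Nonempty (K.chainComplex.homology n ≅
        (InsertionChain.insertionComplex (K.twoSd.translate t).words).homology n)) ∧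
      ∃ Φ : (K.twoSd.translate t).chainComplex ≅
          InsertionChain.insertionComplex (K.twoSd.translate t).words,
        ∀ (Q : InsertionChain.ElemCube d) (hQ : Q ∈ (K.twoSd.translate t).cells),
          InsertionChain.insertionComplexIncl (K.twoSd.translate t).words Q.dim
              ((Φ.hom.f Q.dim).hom ((K.twoSd.translate t).cube Q hQ)) =
            Finsupp.single (InsertionChain.Block.mk (InsertionChain.cubeBlock Q)) 1 := by
    intro t ht
    obtain ⟨Φ, hΦ⟩ := ht.exists_iso
      (InsertionChain.CubicalComplex.mem_translate_twoSd_of_vertices t)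
    refine ⟨?_, fun n => ?_, Φ, hΦ⟩
    · rw [ht.words_eq]
      exact (InsertionChain.CubicalComplex.finite_vertices
        ((InsertionChain.CubicalComplex.finite_cells_twoSd hK).image _)).image _
    · obtain ⟨e⟩ := K.homology_iso_twoSd n
      obtain ⟨e'⟩ := K.twoSd.homology_iso_translate t n
      exact ⟨e ≪≫ e' ≪≫ (HomologicalComplex.homologyFunctor _ _ n).mapIso Φ⟩
  obtain ⟨t, ht⟩ := InsertionChain.CubicalComplex.exists_isNonneg_translate
    (InsertionChain.CubicalComplex.finite_cells_twoSd hK)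
  exact ⟨⟨_, (main t ht).1, (main t ht).2.1⟩, ⟨t, ht⟩, main⟩
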